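/- **Setting.** Let $O_1,\dots,O_T$ be i.i.d. trials with law $P$; a trial contains all variables and their missingness indicators. There are $K\ge 1$ equations. For $k\le K$ let $M_k$ be the event, of positive probability, that no variable of the $k$-th equation is missing in a trial, $\mu_k=P(\cdot\mid M_k)$, $\mathcal D=(O_1,\dots,O_T)$, $\mathcal D_k$ the subsample of the trials lying in $M_k$, and $T_k=|\mathcal D_k|$. For $h=(h_1,\dots,h_{K-1},g)$ in a product class $\mathcal H=\mathcal H_1\times\cdots\times\mathcal H_{K-1}\times\mathcal G$, put $\mathcal T_kh=\mathbb E_{\mu_k}[\alpha_k(h(X),Y_k)\mid Z_k]$ (the arguments $X$ at which the components of $h$ are evaluated may differ between equations). $\|\cdot\|_{\mu_k,2}$ and $\|\cdot\|_{\mathcal D_k,2}$ are the population and empirical $L^2$ norms, $\mathbb E_{\mathcal D_k}$ is the sample mean over $\mathcal D_k$, and $\|\mathcal Th\|_{\mu,2}^2=\sum_k\|\mathcal T_kh\|_{\mu_k,2}^2$. The test classes $\Theta_k$ of functions of $Z_k$ are star-shaped about $0\in\Theta_k$; all functions are measurable; and $\mathcal H_1,\dots,\mathcal H_{K-1},\mathcal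 G,\Theta_1,\dots,\Theta_K$ are pointwise separable (each has a countable subclass that is sequentially dense for pointwise convergence). Define $$\mathcal L_{\mathcal D}(h)=\sum_{k=1}^K\sup_{\theta\in\Theta_k}\Big\{\mathbb E_{\mathcal D_k}[\alpha_k(h(X),Y_k)\theta(Z_k)]-\tfrac12\|\theta\|_{\mathcal D_k,2}^2\Big\},$$ $$\mathrm{CI}_{\mathcal H,\mathcal D}(e)=\Big\{h\in\mathcal H:\mathcal L_{\mathcal D}(h)\le\inf_{h'\in\mathcal H}\mathcal L_{\mathcal D}(h')+e\Big\},$$ and let $\mathrm{CI}_{\mathcal D}(e)$ be the set of last components of elements of $\mathrm{CI}_{\mathcal H,\mathcal D}(e)$. **Assumptions.** * Realizability: $h^*_{\mathcal H}\in\mathcal H$, with last component $g^*_{\mathcal H}$, satisfies $\|\mathcal Th^*_{\mathcal H}\|_{\mu,2}\le\varepsilon_{\mathcal H}$ and $\|g^*_{\mathcal H}-g^*\|_{\nu,2}\le\varepsilon_{\mathcal H}$ for all $\nu$ in a given family $\mathcal V$ of measures. * Compatibility: $\inf_{\theta\in\Theta_k}\|\theta-\mathcal T_kh\|_{\mu_k,2}\le\varepsilon_\Theta$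 for all $h\in\mathcal H$ and all $k$. * Regularity: each $\alpha_k$ is Lipschitz in $(h_1,\dots,h_K,Y_k)$; $\|Y_k\|_\infty\le L_Y$ $\mu_k$-a.s.; $|h_j|\le L_h$ on $\mathcal H$; $|\theta|\le L_\theta$ on every $\Theta_k$; and $|\alpha_k(h(x),y)|\le L_\alpha$ for all $h\in\mathcal H$, all $x$, and $\|y\|_\infty\le L_Y$. **Critical radius.** Let $\xi\in(0,1)$ and $b\ge\max\{1,L_\theta,L_\alpha L_\theta\}$. A number $\delta>0$ is a critical radius of a class $\mathcal F$ on $\mathcal D_k$ if $$\mathbb E_\epsilon\sup_{f\in\mathcal F,\ \|f\|_{\mathcal D_k,2}\le\delta}\frac1{T_k}\sum_{t:\,O_t\in M_k}\epsilon_tf(O_t)\le\frac{\delta^2}{b},$$ where the $\epsilon_t$ are independent uniform signs and the data are fixed. Let $\mathcal Q_k=\{\alpha_k(h(X),Y_k)\theta(Z_k):h\in\mathcal H,\theta\in\Theta_k\}$. For constants $c_0,c_1$, the possibly data-dependent numbers $\eta_k=\eta_k(\mathcal D)$ are said to bound the critical radii if, almost surely, for each $k$ with $T_k\ge1$ there is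 a common critical radius $\delta_k$ of $\mathcal Q_k$ and $\Theta_k$ on $\mathcal D_k$ with $$\eta_k\ge c_0\Big(\delta_k+b\sqrt{\log(c_1/\xi)/T_k}\Big).$$ Put $\eta^2=\sum_k\eta_k^2$, and let $\mathcal E$ be the event that for all $h\in\mathcal H$, all $k$ and all $\theta\in\Theta_k$, $$\big|(\mathbb E_{\mathcal D_k}-\mathbb E_{\mu_k})[\alpha_k(h(X),Y_k)\theta(Z_k)]\big|\le\eta_k\big(L_\alpha\|\theta\|_{\mu_k,2}+\eta_k\big),$$ $$\big|\|\theta\|_{\mathcal D_k,2}^2-\|\theta\|_{\mu_k,2}^2\big|\le\tfrac12\big(\|\theta\|_{\mu_k,2}^2+\eta_k^2\big).$$ **Theorem.** There are universal constants $c_0>0$, $c_1\ge1$, $c_2>0$ such that, under the above assumptions and whenever the $\eta_k$ bound the critical radii with the constants $c_0,c_1$, the (outer) probability that all $\mathcal D_k$ are non-empty and $\mathcal E$ fails is at most $2K\xi$. In particular, $\mathcal E$ holds with probability at least $1-2K\xi$ if the $\mathcal D_k$ are almost surely non-empty. Moreover, on $\mathcal E$: 1. $\mathcal L_{\mathcal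 D}(h^*_{\mathcal H})\le2\varepsilon_{\mathcal H}^2+(2L_\alpha^2+\tfrac54)\eta^2$, and $g^*_{\mathcal H}\in\mathrm{CI}_{\mathcal D}(e_{\mathcal D})$ whenever $e_{\mathcal D}>2\varepsilon_{\mathcal H}^2+(2L_\alpha^2+\tfrac54)\eta^2$. 2. For every $e_{\mathcal D}$, every $h\in\mathrm{CI}_{\mathcal H,\mathcal D}(e_{\mathcal D})$ and every $k$, $$\|\mathcal T_kh\|_{\mu_k,2}\le c_2\big(\varepsilon_\Theta+\varepsilon_{\mathcal H}+\sqrt{e_{\mathcal D}}+(1+L_\alpha)\eta\big).$$ -/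

import Mathlib

open MeasureTheory Filter Topology

noncomputable section

namespace IES

universe u v w

/-- The `L²(μ)` norm of a real function. It is only used for essentially bounded functions and
probability measures. -/
def l2norm {Ω : Type*} [MeasurableSpace Ω] (μ : Measure Ω) (f : Ω → ℝ) : ℝ :=
  Real.sqrt (∫ o, f o ^ 2 ∂μ)

/-! ### Empirical quantities on a subsample `s` of a dataset `D` -/

section Empirical

variable {Ω ι : Type*}

/-- Sample average of `f` over the data points with index in `s`. -/
def empMean (s : Finset ι) (D : ι → Ω) (f : Ω → ℝ) : ℝ :=
  (∑ t ∈ s, f (D t)) / (s.card : ℝ)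

/-- Empirical `L²` norm of `f` over the data points with index in `s`. -/
def empNorm (s : Finset ι) (D : ι → Ω) (f : Ω → ℝ) : ℝ :=
  Real.sqrt (empMean s D (fun o => f o ^ 2))

/-- Localized empirical Rademacher complexity: the expectation, over independent uniform signs
`ε` and with the data fixed, of the supremum of the signed averages `(1/|s|) ∑ ε_t f(D_t)` over
all `f ∈ F` of empirical norm at most `r`. -/
def empRademacher [Fintype ι] [DecidableEq ι] (s : Finset ι) (D : ι → Ω) (F : Set (Ω → ℝ))
    (r : ℝ) : ℝ :=
  (∑ ε : ι → ℤˣ, ⨆ f : {f : Ω → ℝ // f ∈ F ∧ empNorm s D f ≤ r},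
      (∑ t ∈ s, ((ε t : ℤ) : ℝ) * f.1 (D t)) / (s.card : ℝ)) /
    (Fintype.card (ι → ℤˣ) : ℝ)

/-- `δ` is a critical radius on the subsample `s` of `D` of the class `F` of `[-b, b]`-valued
functions. -/
def IsCriticalRadius [Fintype ι] [DecidableEq ι] (s : Finset ι) (D : ι → Ω) (F : Set (Ω → ℝ))
    (b δ : ℝ) : Prop :=
  0 < δ ∧ empRademacher s D F δ ≤ δ ^ 2 / b

end Empirical

/-- Pointwise separability of a function class: some countable subclass is sequentially dense in
it for pointwise convergence. -/
def PointwiseSeparable {S : Type*} (F : Set (S → ℝ)) : Prop :=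
  ∃ C : Set (S → ℝ), C ⊆ F ∧ C.Countable ∧
    ∀ f ∈ F, ∃ a : ℕ → S → ℝ, (∀ n, a n ∈ C) ∧ ∀ x, Tendsto (fun n => a n x) atTop (𝓝 (f x))

/-- A system of `K = m + 1` conditional moment equations
`E[α_k(h(X), Y_k) | Z_k] = 0`, where the expectation in the `k`-th equation is taken under the law
of a trial conditioned on the event that the variables of this equation are not missing.

`Trial` is the space of trials (all variables together with their missingness indicators). In the
`k`-th equation, the `j`-th unknown `h_j` is evaluated at the variable `X k j`. -/
structure MomentSystem (m : ℕ) where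
  Trial : Type u
  [measTrial : MeasurableSpace Trial]
  /-- the law of one trial -/
  law : Measure Trial
  [isProb : IsProbabilityMeasure law]
  /-- the space of arguments of the `j`-th unknown function -/
  Arg : Fin (m + 1) → Type v
  [measArg : ∀ j, MeasurableSpace (Arg j)]
  /-- the space of conditioning variables of the `k`-th equation -/
  Inst : Fin (m + 1) → Type w
  [measInst : ∀ k, MeasurableSpace (Inst k)]
  dimY : Fin (m + 1) → ℕ
  X : ∀ _k j : Fin (m + 1), Trial → Arg j
  Y : ∀ k : Fin (m + 1), Trial → (Fin (dimY k) → ℝ)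
  Z : ∀ k : Fin (m + 1), Trial → Inst k
  measurable_X : ∀ k j, Measurable (X k j)
  measurable_Y : ∀ k, Measurable (Y k)
  measurable_Z : ∀ k, Measurable (Z k)
  /-- the trials in which no variable of the `k`-th equation is missing -/
  observed : Fin (m + 1) → Set Trial
  measurableSet_observed : ∀ k, MeasurableSet (observed k)
  law_observed : ∀ k, law (observed k) ≠ 0
  α : ∀ k : Fin (m + 1), (Fin (m + 1) → ℝ) → (Fin (dimY k) → ℝ) → ℝ

attribute [instance] MomentSystem.measTrial MomentSystem.isProb MomentSystem.measArg
  MomentSystem.measInst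

namespace MomentSystem

variable {m : ℕ} (M : MomentSystem.{u, v, w} m)

/-- Vectors `h = (h_1, …, h_{K-1}, g)` of functions. -/
abbrev Fns : Type v := ∀ j : Fin (m + 1), M.Arg j → ℝ

/-- The law `μ_k` of a trial given that the variables of the `k`-th equation are observed. -/
def μ (k : Fin (m + 1)) : Measure M.Trial := ProbabilityTheory.cond M.law (M.observed k)

/-- `α_k(h(X), Y_k)`, as a function of the trial. -/
def res (k : Fin (m + 1)) (h : M.Fns) (o : M.Trial) : ℝ :=
  M.α k (fun j => h j (M.X k j o)) (M.Y k o)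

/-- `θ(Z_k)`, as a function of the trial. -/
def test (k : Fin (m + 1)) (θ : M.Inst k → ℝ) (o : M.Trial) : ℝ := θ (M.Z k o)

/-- `(T_k h)(Z_k) = E_{μ_k}[α_k(h(X), Y_k) | Z_k]`, as a function of the trial. -/
def T (k : Fin (m + 1)) (h : M.Fns) : M.Trial → ℝ :=
  condExp (MeasurableSpace.comap (M.Z k) inferInstance) (M.μ k) (M.res k h)

/-- The root of the residual mean squared error `‖T h‖²_{μ,2} = ∑_k ‖T_k h‖²_{μ_k,2}`. -/
def rmse (h : M.Fns) : ℝ := Real.sqrt (∑ k, l2norm (M.μ k) (M.T k h) ^ 2)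

/-- The hypothesis space `H_1 × ⋯ × H_{K-1} × G`. -/
def hyp (H : ∀ j, Set (M.Arg j → ℝ)) : Set M.Fns := {h | ∀ j, h j ∈ H j}

/-- Realizability, with error `ε`, by `hH` : `T hH` is small in `L²(μ)` and the last component of
`hH` is close to `gstar` in `L²(ν)` for every `ν ∈ V`. -/
def Realizable (H : ∀ j, Set (M.Arg j → ℝ)) (V : Set (Measure (M.Arg (Fin.last m))))
    (gstar : M.Arg (Fin.last m) → ℝ) (ε : ℝ) (hH : M.Fns) : Prop :=
  hH ∈ M.hyp H ∧ M.rmse hH ≤ ε ∧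
    ∀ ν ∈ V, eLpNorm (fun x => hH (Fin.last m) x - gstar x) 2 ν ≤ ENNReal.ofReal ε

/-- Compatibility of the test classes, with error `ε`. -/
def Compatible (H : ∀ j, Set (M.Arg j → ℝ)) (Θ : ∀ k, Set (M.Inst k → ℝ)) (ε : ℝ) : Prop :=
  ∀ h ∈ M.hyp H, ∀ k,
    ⨅ θ : Θ k, l2norm (M.μ k) (fun o => M.test k θ.1 o - M.T k h o) ≤ ε

/-- Regularity of the functions `α_k`, of the variables `Y_k` and of the classes. -/
structure Regular (H : ∀ j, Set (M.Arg j → ℝ)) (Θ : ∀ k, Set (M.Inst k → ℝ))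
    (Lα₁ LY Lh Lθ Lα : ℝ) : Prop where
  lipschitz : ∀ k u y u' y',
    |M.α k u y - M.α k u' y'| ≤ Lα₁ * (∑ j, |u j - u' j| + ‖y - y'‖)
  bounded_Y : ∀ k, ∀ᵐ o ∂(M.μ k), ‖M.Y k o‖ ≤ LY
  measurable_H : ∀ j, ∀ f ∈ H j, Measurable f
  bounded_H : ∀ j, ∀ f ∈ H j, ∀ x, |f x| ≤ Lh
  measurable_Θ : ∀ k, ∀ θ ∈ Θ k, Measurable θ
  bounded_Θ : ∀ k, ∀ θ ∈ Θ k, ∀ z, |θ z| ≤ Lθ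
  bounded_α : ∀ k, ∀ h ∈ M.hyp H, ∀ (x : ∀ j, M.Arg j) (y : Fin (M.dimY k) → ℝ),
    ‖y‖ ≤ LY → |M.α k (fun j => h j (x j)) y| ≤ Lα

/-- The class `Q_k` of the functions `α_k(h(X), Y_k) θ(Z_k)` of the trial. -/
def Q (H : ∀ j, Set (M.Arg j → ℝ)) (Θ : ∀ k, Set (M.Inst k → ℝ)) (k : Fin (m + 1)) :
    Set (M.Trial → ℝ) :=
  {q | ∃ h ∈ M.hyp H, ∃ θ ∈ Θ k, q = fun o => M.res k h o * M.test k θ o}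

/-- The class of the functions `θ(Z_k)`, `θ ∈ Θ_k`, of the trial. -/
def testClass (Θ : ∀ k, Set (M.Inst k → ℝ)) (k : Fin (m + 1)) : Set (M.Trial → ℝ) :=
  {q | ∃ θ ∈ Θ k, q = M.test k θ}

section Data

variable {n : ℕ}

open Classical in
/-- The indices of the subsample `D_k` of the dataset `D` that is used in the `k`-th equation. -/
def sub (k : Fin (m + 1)) (D : Fin n → M.Trial) : Finset (Fin n) :=
  Finset.univ.filter (fun t => D t ∈ M.observed k)

/-- The empirical loss
`L_{k,D}(h) = sup_{θ ∈ Θ_k} E_{D_k}[α_k(h(X), Y_k) θ(Z_k)] - ‖θ‖²_{D_k,2} / 2`. -/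
def lossK (Θ : ∀ k, Set (M.Inst k → ℝ)) (D : Fin n → M.Trial) (k : Fin (m + 1)) (h : M.Fns) :
    ℝ :=
  ⨆ θ : Θ k, (empMean (M.sub k D) D (fun o => M.res k h o * M.test k θ.1 o)
    - 1 / 2 * empNorm (M.sub k D) D (M.test k θ.1) ^ 2)

/-- The empirical loss `L_D(h) = ∑_k L_{k,D}(h)`. -/
def loss (Θ : ∀ k, Set (M.Inst k → ℝ)) (D : Fin n → M.Trial) (h : M.Fns) : ℝ :=
  ∑ k, M.lossK Θ D k h

/-- The confidence set in the hypothesis space, with threshold `e`. -/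
def confH (H : ∀ j, Set (M.Arg j → ℝ)) (Θ : ∀ k, Set (M.Inst k → ℝ)) (D : Fin n → M.Trial)
    (e : ℝ) : Set M.Fns :=
  {h | h ∈ M.hyp H ∧ M.loss Θ D h ≤ (⨅ h' : M.hyp H, M.loss Θ D h'.1) + e}

/-- The confidence set for the last component, with threshold `e`. -/
def conf (H : ∀ j, Set (M.Arg j → ℝ)) (Θ : ∀ k, Set (M.Inst k → ℝ)) (D : Fin n → M.Trial)
    (e : ℝ) : Set (M.Arg (Fin.last m) → ℝ) :=
  {g | g ∈ H (Fin.last m) ∧ ∃ h ∈ M.confH H Θ D e, g = h (Fin.last m)}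

/-- The uniform deviation event; the radii `η k` may depend on the data. -/
def event (H : ∀ j, Set (M.Arg j → ℝ)) (Θ : ∀ k, Set (M.Inst k → ℝ)) (Lα : ℝ)
    (η : Fin (m + 1) → (Fin n → M.Trial) → ℝ) : Set (Fin n → M.Trial) :=
  {D | ∀ h ∈ M.hyp H, ∀ k, ∀ θ ∈ Θ k,
    |empMean (M.sub k D) D (fun o => M.res k h o * M.test k θ o)
        - ∫ o, M.res k h o * M.test k θ o ∂(M.μ k)|
      ≤ η k D * (Lα * l2norm (M.μ k) (M.test k θ) + η k D) ∧
    |empNorm (M.sub k D) D (M.test k θ) ^ 2 - l2norm (M.μ k) (M.test k θ) ^ 2|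
      ≤ 1 / 2 * (l2norm (M.μ k) (M.test k θ) ^ 2 + η k D ^ 2)}

/-- `η k` bounds, at confidence level `ξ` and with constants `c₀`, `c₁`, a critical radius common
to `Q_k` and `Θ_k` on the subsample `D_k`, for almost every dataset `D` of `n` independent
trials in which `D_k` is not empty. -/
def BoundsCriticalRadius (H : ∀ j, Set (M.Arg j → ℝ)) (Θ : ∀ k, Set (M.Inst k → ℝ))
    (c₀ c₁ b ξ : ℝ) (η : Fin (m + 1) → (Fin n → M.Trial) → ℝ) : Prop :=
  ∀ k, ∀ᵐ D ∂(Measure.pi fun _ : Fin n => M.law), (M.sub k D).Nonempty →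
    ∃ δ : ℝ, IsCriticalRadius (M.sub k D) D (M.Q H Θ k) b δ ∧
      IsCriticalRadius (M.sub k D) D (M.testClass Θ k) b δ ∧
      c₀ * (δ + b * Real.sqrt (Real.log (c₁ / ξ) / ((M.sub k D).card : ℝ))) ≤ η k D

end Data

end MomentSystem

end IES

end

/-! The deterministic half is a quadratic argument on the deviation event. Conditioning on `Z_k`
replaces the residual by `T_k h`. For a test function of norm `t`, the objective at `hH` is then at
most `(‖T_k hH‖ + Lα η) t - t²/4 + 5η²/4`, and maximizing over `t` gives the first claim.
Conversely, if `h` is in the confidence set, a test function close to `T_k h` gains about `t²/4` up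
to linear errors. The loss of `h` is small, so `t`, and with it `‖T_k h‖`, is small.

The probabilistic half must cope with a critical radius that is computed from the data. For a fixed
radius `r` and `R = N r²`, `pi_not_concentrates_le` bounds the probability that the empirical
complexity at `r` is at most `R` and yet some function of the class fails to concentrate at scale
`4096 r`. The bound `8 exp(-R)` is summable over dyadic radii, so one exceptional set serves all
radii. Off it, star-shapedness turns any empirical critical radius into a complexity bound at a
comparable dyadic radius (`rad_le_of_isCriticalRadius`).

For a fixed radius, a ghost sample is added. A failure of concentration yields, after rescaling the
function by a power of two, a large difference between the two samples at bounded joint norm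
(`exists_scale_of_deviation`). The coordinates of the two samples are then swapped by random signs,
with the pair fixed. The difference becomes a signed sum, but the complexity condition bears on the
mixed first sample and so depends on the same signs. A dichotomy (`expect_swap_tail_le`) removes
this dependence. If one of the two samples has jointly localized complexity above `9R`, the mixed
sample inherits enough of it that its complexity is rarely at most `R` (`expect_exp_neg_mixed_le`).
Otherwise both complexities are at most `9R`; contraction and rescaling bound the mean of the
supremum of the signed differences, and a Maurey-type exponential inequality
(`expect_exp_iSup_mul_le_one`) bounds its upper tail.

Passing to the subsample of an equation costs nothing: given which trials are complete, those trials
are independent with law `μ_k`. Pointwise separability reduces every supremum to a countable, hence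
measurable, one. -/

namespace IES

open scoped BigOperators

/-! ### Rademacher signs: contraction and exponential deviation of suprema -/

section Signs

variable {ι κ : Type*} [Fintype ι] [DecidableEq ι]

/-- Averaging over one sign first does not change an average over signs. -/
lemma expect_update (t : ι) (G : (ι → ℤˣ) → ℝ) :
    𝔼 σ, G σ = 𝔼 σ : ι → ℤˣ,
      (G (Function.update σ t 1) + G (Function.update σ t (-1))) / 2 := by
  have inv : Function.Involutive (fun σ : ι → ℤˣ => Function.update σ t (-σ t)) := by
    intro σ; simp
  have h1 : 𝔼 σ, G σ = 𝔼 σ : ι → ℤˣ, G (Function.update σ t (-σ t)) :=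
    (Fintype.expect_equiv inv.toPerm _ _ (fun σ => rfl)).symm
  have h2 : ∀ σ : ι → ℤˣ, (G (Function.update σ t 1) + G (Function.update σ t (-1))) / 2
      = (G σ + G (Function.update σ t (-σ t))) / 2 := by
    intro σ
    rcases Int.units_eq_one_or (σ t) with h | h
    · rw [h, ← h, Function.update_eq_self, h]
    · rw [h, neg_neg, ← h, Function.update_eq_self]; ring
  simp_rw [h2]
  rw [← Finset.expect_div, Finset.expect_add_distrib, ← h1]; ring

omit [Fintype ι] in
lemma sum_update_sign {T : Finset ι} {t : ι} (ht : t ∉ T) (σ : ι → ℤˣ) (e : ℤˣ) (x : ι → ℝ) :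
    ∑ u ∈ insert t T, ((Function.update σ t e u : ℤ) : ℝ) * x u
      = ((e : ℤ) : ℝ) * x t + ∑ u ∈ T, ((σ u : ℤ) : ℝ) * x u := by
  rw [Finset.sum_insert ht]
  congr 1
  · simp
  · refine Finset.sum_congr rfl fun u hu => ?_
    rw [Function.update_of_ne (by rintro rfl; exact ht hu)]

lemma abs_sign_mul (e : ℤˣ) (x : ℝ) : |((e : ℤ) : ℝ) * x| = |x| := by
  rcases Int.units_eq_one_or e with h | h <;> simp [h]

omit [Fintype ι] [DecidableEq ι] in
lemma abs_sum_sign_le (T : Finset ι) (σ : ι → ℤˣ) (x : ι → ℝ) {B : ℝ} (h : ∀ t, |x t| ≤ B) :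
    |∑ t ∈ T, ((σ t : ℤ) : ℝ) * x t| ≤ T.card * B := by
  refine (Finset.abs_sum_le_sum_abs _ _).trans ?_
  simp_rw [abs_sign_mul]
  exact (Finset.sum_le_card_nsmul _ _ _ fun t _ => h t).trans (by simp)

lemma bddAbove_of_abs_le {x : κ → ℝ} {C : ℝ} (h : ∀ i, |x i| ≤ C) : BddAbove (Set.range x) :=
  ⟨C, by rintro _ ⟨i, rfl⟩; exact (abs_le.1 (h i)).2⟩

omit [Fintype ι] [DecidableEq ι] in
lemma abs_add_sum_sign_le (T : Finset ι) (σ : ι → ℤˣ) (x : ι → ℝ) {B c C : ℝ}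
    (h : ∀ t, |x t| ≤ B) (hc : |c| ≤ C) :
    |c + ∑ t ∈ T, ((σ t : ℤ) : ℝ) * x t| ≤ C + T.card * B :=
  (abs_add_le _ _).trans (add_le_add hc (abs_sum_sign_le T σ x h))

variable [Nonempty κ]

/-- The contraction principle for averages over signs. -/
lemma expect_iSup_contraction (T : Finset ι) (φ ψ : κ → ι → ℝ) {B : ℝ}
    (hφ : ∀ i t, |φ i t| ≤ B) (hψ : ∀ i t, |ψ i t| ≤ B)
    (hφψ : ∀ i j t, |φ i t - φ j t| ≤ |ψ i t - ψ j t|) :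
    ∀ (c : κ → ℝ) (C : ℝ), (∀ i, |c i| ≤ C) →
    𝔼 σ : ι → ℤˣ, ⨆ i, (c i + ∑ t ∈ T, ((σ t : ℤ) : ℝ) * φ i t)
      ≤ 𝔼 σ : ι → ℤˣ, ⨆ i, (c i + ∑ t ∈ T, ((σ t : ℤ) : ℝ) * ψ i t) := by
  induction T using Finset.induction_on with
  | empty => intro c C hc; simp
  | insert t T ht ih =>
    intro c C hc
    rw [expect_update t, expect_update t (fun σ => ⨆ i, (c i + ∑ t ∈ insert t T, ((σ t : ℤ) : ℝ) * ψ i t))]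
    simp_rw [sum_update_sign ht]
    have key : ∀ (σ : ι → ℤˣ),
        ((⨆ i, (c i + ((((1 : ℤˣ) : ℤ) : ℝ) * φ i t + ∑ u ∈ T, ((σ u : ℤ) : ℝ) * φ i u))) +
          ⨆ i, (c i + ((((-1 : ℤˣ) : ℤ) : ℝ) * φ i t + ∑ u ∈ T, ((σ u : ℤ) : ℝ) * φ i u))) / 2
        ≤ ((⨆ i, ((c i + ψ i t) + ∑ u ∈ T, ((σ u : ℤ) : ℝ) * φ i u)) +
          ⨆ i, ((c i + -ψ i t) + ∑ u ∈ T, ((σ u : ℤ) : ℝ) * φ i u)) / 2 := by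
      intro σ
      have hb1 : BddAbove (Set.range fun i => (c i + ψ i t) + ∑ u ∈ T, ((σ u : ℤ) : ℝ) * φ i u) :=
        bddAbove_of_abs_le fun i => abs_add_sum_sign_le T σ _ (hφ i)
          ((abs_add_le _ _).trans (add_le_add (hc i) (hψ i t)))
      have hb2 : BddAbove (Set.range fun i => (c i + -ψ i t) + ∑ u ∈ T, ((σ u : ℤ) : ℝ) * φ i u) :=
        bddAbove_of_abs_le fun i => abs_add_sum_sign_le T σ _ (hφ i)
          ((abs_add_le _ _).trans (add_le_add (hc i) ((abs_neg _).trans_le (hψ i t))))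
      refine div_le_div_of_nonneg_right ?_ zero_le_two
      -- The two suprema on the left are tested at an arbitrary pair `i`, `j`. Depending on the sign
      -- of `ψ i t - ψ j t`, the pair `(i, j)` or `(j, i)` dominates on the right.
      rw [← le_sub_iff_add_le]
      refine ciSup_le fun i => ?_
      rw [le_sub_comm]
      refine ciSup_le fun j => ?_
      have h := hφψ i j t
      have l1 := le_ciSup hb1 i
      have l2 := le_ciSup hb2 j
      have l3 := le_ciSup hb1 j
      have l4 := le_ciSup hb2 i
      simp only [Units.val_one, Int.cast_one, one_mul, Units.val_neg, Int.cast_neg, neg_mul] at *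
      have h' := (le_abs_self _).trans h
      rcases abs_cases (ψ i t - ψ j t) with ⟨h0, _⟩ | ⟨h0, _⟩ <;> rw [h0] at h' <;> linarith
    refine (Finset.expect_le_expect fun σ _ => key σ).trans ?_
    rw [← Finset.expect_div, ← Finset.expect_div, Finset.expect_add_distrib,
      Finset.expect_add_distrib]
    have i1 := ih (fun i => c i + ψ i t) (C + B)
      (fun i => (abs_add_le _ _).trans (add_le_add (hc i) (hψ i t)))
    have i2 := ih (fun i => c i + -ψ i t) (C + B)
      (fun i => (abs_add_le _ _).trans (add_le_add (hc i) ((abs_neg _).trans_le (hψ i t))))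
    simp only [Units.val_one, Int.cast_one, one_mul, Units.val_neg, Int.cast_neg, neg_mul,
      add_assoc]
    simp only [add_assoc] at i1 i2
    linarith

/-- The Padé approximant `(2 + u) / (2 - u)` dominates the exponential on the unit interval; a cubic
Taylor bound suffices. This closes the one-coordinate inequality `two_point_aux`. -/
lemma exp_le_two_add_div {u : ℝ} (h0 : 0 ≤ u) (h1 : u ≤ 1) :
    Real.exp u * (2 - u) ≤ 2 + u := by
  have h := Real.exp_bound' h0 h1 (n := 3) (by norm_num)
  norm_num [Finset.sum_range_succ, Nat.factorial] at h
  have h3 : 0 ≤ u ^ 3 := by positivity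
  nlinarith [mul_le_mul_of_nonneg_right h (by linarith : (0 : ℝ) ≤ 2 - u), mul_nonneg h3 h0]

/-- The one-coordinate case of the Maurey-type inequality: `p`, `q` are the averages of `exp(-sup)`
for the two values of a sign, and `X`, `Y` those of the penalized exponential. The term for the
larger of `p`, `q` needs only `l = 0`; the other needs an interpolation parameter `l` adapted to `q
/ p`. -/
lemma two_point_aux {p q X Y : ℝ} (hq : 0 < q) (hqp : q ≤ p) (hX : X * p ≤ 1)
    (hY : ∀ l : ℝ, 0 ≤ l → l ≤ 1 →
      Y ≤ Real.exp (l ^ 2 / 4 - (1 - l) * Real.log q - l * Real.log p)) :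
    (X + Y) * (p + q) ≤ 4 := by
  have hp : 0 < p := hq.trans_le hqp
  obtain ⟨w, hw0, hwq⟩ : ∃ w : ℝ, 0 < w ∧ q = p * w ^ 2 :=
    ⟨Real.sqrt (q / p), Real.sqrt_pos.2 (div_pos hq hp), by
      rw [Real.sq_sqrt (div_pos hq hp).le]; field_simp⟩
  have hw2 : w ^ 2 ≤ 1 := le_of_mul_le_mul_left (by rwa [mul_one, ← hwq]) hp
  have hw1 : w ≤ 1 := (sq_le_one_iff₀ hw0.le).1 hw2
  -- The choice `l = 1 - q / p`. With `-log w ≤ 1/w - 1`, the exponent of `Y * p` is at most `1 -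
  -- w²`, with room `(1 - w)² (4 - (1 + w)²) / 4`.
  have h := hY (1 - w ^ 2) (by linarith) (by nlinarith)
  rw [hwq, Real.log_mul hp.ne' (by positivity), Real.log_pow] at h
  have hlog : -Real.log w ≤ w⁻¹ - 1 := by
    rw [← Real.log_inv]; exact Real.log_le_sub_one_of_pos (inv_pos.2 hw0)
  have hlog' : w ^ 2 * (-Real.log w) ≤ w - w ^ 2 := by
    calc w ^ 2 * (-Real.log w) ≤ w ^ 2 * (w⁻¹ - 1) := by gcongr
      _ = w - w ^ 2 := by field_simp
  have hY' : Y ≤ Real.exp (1 - w ^ 2) * p⁻¹ := by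
    refine h.trans ?_
    rw [← Real.exp_log (inv_pos.2 hp), ← Real.exp_add, Real.exp_le_exp, Real.log_inv]
    push_cast
    nlinarith [sq_nonneg (1 - w), mul_nonneg (sq_nonneg (1 - w)) (by nlinarith : 0 ≤ 4 - (1 + w) ^ 2)]
  have hYp : Y * p ≤ Real.exp (1 - w ^ 2) := by
    calc Y * p ≤ Real.exp (1 - w ^ 2) * p⁻¹ * p := by gcongr
      _ = _ := by field_simp
  have he := exp_le_two_add_div (u := 1 - w ^ 2) (by linarith) (by nlinarith)
  calc (X + Y) * (p + q) = (X * p + Y * p) * (1 + w ^ 2) := by rw [hwq]; ring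
    _ ≤ (1 + Real.exp (1 - w ^ 2)) * (1 + w ^ 2) := by gcongr
    _ ≤ 4 := by nlinarith

lemma two_point {p q X Y : ℝ} (hp : 0 < p) (hq : 0 < q)
    (hX : ∀ l : ℝ, 0 ≤ l → l ≤ 1 →
      X ≤ Real.exp (l ^ 2 / 4 - (1 - l) * Real.log p - l * Real.log q))
    (hY : ∀ l : ℝ, 0 ≤ l → l ≤ 1 →
      Y ≤ Real.exp (l ^ 2 / 4 - (1 - l) * Real.log q - l * Real.log p)) :
    (X + Y) * (p + q) ≤ 4 := by
  have aux : ∀ {x X : ℝ}, 0 < x → X ≤ Real.exp (-Real.log x) → X * x ≤ 1 := by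
    intro x X hx h
    rw [Real.exp_neg, Real.exp_log hx] at h
    calc X * x ≤ x⁻¹ * x := by gcongr
      _ = 1 := by field_simp
  rcases le_total q p with h | h
  · exact two_point_aux hq h (aux hp (by simpa using hX 0 le_rfl zero_le_one)) hY
  · have := two_point_aux hp h (aux hq (by simpa using hY 0 le_rfl zero_le_one)) hX
    linarith

lemma expect_exp_pos (F : (ι → ℤˣ) → ℝ) : 0 < 𝔼 σ, Real.exp (F σ) :=
  Finset.expect_pos (fun _ _ => Real.exp_pos _) Finset.univ_nonempty

/-- Log-convexity of exponential averages. -/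
lemma expect_exp_convex (F G : (ι → ℤˣ) → ℝ) {l : ℝ} (h0 : 0 ≤ l) (h1 : l ≤ 1) :
    𝔼 σ, Real.exp ((1 - l) * F σ + l * G σ) ≤
      Real.exp ((1 - l) * Real.log (𝔼 σ, Real.exp (F σ)) +
        l * Real.log (𝔼 σ, Real.exp (G σ))) := by
  set P := 𝔼 σ, Real.exp (F σ) with hP
  set Q := 𝔼 σ, Real.exp (G σ) with hQ
  have hP0 : 0 < P := expect_exp_pos F
  have hQ0 : 0 < Q := expect_exp_pos G
  have key : ∀ σ, Real.exp ((1 - l) * F σ + l * G σ) ≤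
      Real.exp ((1 - l) * Real.log P + l * Real.log Q) *
        ((1 - l) * (Real.exp (F σ) / P) + l * (Real.exp (G σ) / Q)) := by
    intro σ
    have hc := convexOn_exp.2 (Set.mem_univ (F σ - Real.log P)) (Set.mem_univ (G σ - Real.log Q))
      (by linarith : 0 ≤ 1 - l) h0 (by ring)
    simp only [smul_eq_mul, Real.exp_sub, Real.exp_log hP0, Real.exp_log hQ0] at hc
    calc _ = Real.exp ((1 - l) * Real.log P + l * Real.log Q) *
          Real.exp ((1 - l) * (F σ - Real.log P) + l * (G σ - Real.log Q)) := by
            rw [← Real.exp_add]; congr 1; ring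
      _ ≤ _ := by gcongr
  refine (Finset.expect_le_expect fun σ _ => key σ).trans ?_
  rw [← Finset.mul_expect, Finset.expect_add_distrib, ← Finset.mul_expect, ← Finset.mul_expect,
    ← Finset.expect_div, ← Finset.expect_div, ← hP, ← hQ, div_self hP0.ne', div_self hQ0.ne']
  simp

/-- An exponential deviation inequality of Maurey type for suprema of affine functions of
independent signs. -/
lemma expect_exp_iSup_mul_le_one (T : Finset ι) (a : κ → ι → ℝ) {B : ℝ}
    (ha : ∀ i t, |a i t| ≤ B) :
    ∀ (c : κ → ℝ) (C : ℝ), (∀ i, |c i| ≤ C) →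
    (𝔼 σ : ι → ℤˣ, Real.exp (⨆ i, (c i - 4 * ∑ t ∈ T, a i t ^ 2
        + ∑ t ∈ T, ((σ t : ℤ) : ℝ) * a i t))) *
      𝔼 σ : ι → ℤˣ, Real.exp (-⨆ i, (c i + ∑ t ∈ T, ((σ t : ℤ) : ℝ) * a i t)) ≤ 1 := by
  induction T using Finset.induction_on with
  | empty => intro c C hc; simp [← Real.exp_add]
  | insert t T ht ih =>
    intro c C hc
    rw [expect_update t, expect_update t (fun σ => Real.exp
      (-⨆ i, (c i + ∑ t ∈ insert t T, ((σ t : ℤ) : ℝ) * a i t)))]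
    simp_rw [sum_update_sign ht, Finset.sum_insert ht]
    simp only [Units.val_one, Int.cast_one, one_mul, Units.val_neg, Int.cast_neg, neg_mul]
    rw [← Finset.expect_div, ← Finset.expect_div, Finset.expect_add_distrib,
      Finset.expect_add_distrib]
    have hcp : ∀ i, |c i + a i t| ≤ C + B := fun i =>
      (abs_add_le _ _).trans (add_le_add (hc i) (ha i t))
    have hcm : ∀ i, |c i + -a i t| ≤ C + B := fun i =>
      (abs_add_le _ _).trans (add_le_add (hc i) ((abs_neg _).trans_le (ha i t)))
    have ip := ih (fun i => c i + a i t) (C + B) hcp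
    have im := ih (fun i => c i + -a i t) (C + B) hcm
    have hbdd : ∀ (d : κ → ℝ), (∀ i, |d i| ≤ C + B) → ∀ σ : ι → ℤˣ,
        BddAbove (Set.range fun i => d i - 4 * ∑ u ∈ T, a i u ^ 2 +
          ∑ u ∈ T, ((σ u : ℤ) : ℝ) * a i u) := by
      intro d hd σ
      refine ⟨C + B + T.card * B, ?_⟩
      rintro _ ⟨i, rfl⟩
      have h1 := (abs_le.1 (abs_add_sum_sign_le T σ (a i) (ha i) (hd i))).2
      have h2 : 0 ≤ ∑ u ∈ T, a i u ^ 2 := Finset.sum_nonneg fun u _ => sq_nonneg _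
      simp only
      linarith
    simp only [← add_assoc]
    set p := 𝔼 σ : ι → ℤˣ, Real.exp (-⨆ i, (c i + a i t + ∑ u ∈ T, ((σ u : ℤ) : ℝ) * a i u))
      with hp
    set q := 𝔼 σ : ι → ℤˣ, Real.exp (-⨆ i, (c i + -a i t + ∑ u ∈ T, ((σ u : ℤ) : ℝ) * a i u))
      with hq
    have hp0 : 0 < p := expect_exp_pos _
    have hq0 : 0 < q := expect_exp_pos _
    set F : (ι → ℤˣ) → ℝ := fun σ => ⨆ i, (c i + a i t - 4 * ∑ u ∈ T, a i u ^ 2 +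
      ∑ u ∈ T, ((σ u : ℤ) : ℝ) * a i u) with hF
    set G : (ι → ℤˣ) → ℝ := fun σ => ⨆ i, (c i + -a i t - 4 * ∑ u ∈ T, a i u ^ 2 +
      ∑ u ∈ T, ((σ u : ℤ) : ℝ) * a i u) with hG
    have hFlog : Real.log (𝔼 σ, Real.exp (F σ)) ≤ -Real.log p := by
      have := Real.log_nonpos (by have := expect_exp_pos F; positivity) ip
      rw [Real.log_mul (expect_exp_pos F).ne' hp0.ne'] at this
      linarith
    have hGlog : Real.log (𝔼 σ, Real.exp (G σ)) ≤ -Real.log q := by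
      have := Real.log_nonpos (by have := expect_exp_pos G; positivity) im
      rw [Real.log_mul (expect_exp_pos G).ne' hq0.ne'] at this
      linarith
    -- The penalty `4x²` pays for moving a fraction `l` of the weight from sign `+1` to sign `-1`.
    -- Thus the penalized supremum is at most `l²/4` plus a convex combination of the two suprema
    -- covered by induction.
    have elem : ∀ x l : ℝ, x - 4 * x ^ 2 ≤ (1 - 2 * l) * x + l ^ 2 / 4 := by
      intro x l; nlinarith [sq_nonneg (2 * x - l / 2)]
    have hU : ∀ l : ℝ, 0 ≤ l → l ≤ 1 →
        𝔼 σ : ι → ℤˣ, Real.exp (⨆ i, (c i - 4 * (a i t ^ 2 + ∑ u ∈ T, a i u ^ 2) + a i t +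
          ∑ u ∈ T, ((σ u : ℤ) : ℝ) * a i u))
        ≤ Real.exp (l ^ 2 / 4 - (1 - l) * Real.log p - l * Real.log q) := by
      intro l h0 h1
      have step : ∀ σ : ι → ℤˣ, Real.exp (⨆ i, (c i - 4 * (a i t ^ 2 + ∑ u ∈ T, a i u ^ 2) +
          a i t + ∑ u ∈ T, ((σ u : ℤ) : ℝ) * a i u))
          ≤ Real.exp (l ^ 2 / 4) * Real.exp ((1 - l) * F σ + l * G σ) := by
        intro σ
        rw [← Real.exp_add, Real.exp_le_exp]
        refine ciSup_le fun i => ?_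
        have h3 := mul_le_mul_of_nonneg_left (le_ciSup (hbdd _ hcp σ) i) (sub_nonneg.2 h1)
        have h4 := mul_le_mul_of_nonneg_left (le_ciSup (hbdd _ hcm σ) i) h0
        have h5 := elem (a i t) l
        simp only [hF, hG]
        linarith
      refine (Finset.expect_le_expect fun σ _ => step σ).trans ?_
      rw [← Finset.mul_expect]
      calc _ ≤ Real.exp (l ^ 2 / 4) * _ :=
            mul_le_mul_of_nonneg_left (expect_exp_convex F G h0 h1) (Real.exp_pos _).le
        _ ≤ _ := by
          rw [← Real.exp_add, Real.exp_le_exp]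
          nlinarith [mul_le_mul_of_nonneg_left hFlog (sub_nonneg.2 h1),
            mul_le_mul_of_nonneg_left hGlog h0]
    have hV : ∀ l : ℝ, 0 ≤ l → l ≤ 1 →
        𝔼 σ : ι → ℤˣ, Real.exp (⨆ i, (c i - 4 * (a i t ^ 2 + ∑ u ∈ T, a i u ^ 2) + -a i t +
          ∑ u ∈ T, ((σ u : ℤ) : ℝ) * a i u))
        ≤ Real.exp (l ^ 2 / 4 - (1 - l) * Real.log q - l * Real.log p) := by
      intro l h0 h1
      have step : ∀ σ : ι → ℤˣ, Real.exp (⨆ i, (c i - 4 * (a i t ^ 2 + ∑ u ∈ T, a i u ^ 2) +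
          -a i t + ∑ u ∈ T, ((σ u : ℤ) : ℝ) * a i u))
          ≤ Real.exp (l ^ 2 / 4) * Real.exp ((1 - l) * G σ + l * F σ) := by
        intro σ
        rw [← Real.exp_add, Real.exp_le_exp]
        refine ciSup_le fun i => ?_
        have h3 := mul_le_mul_of_nonneg_left (le_ciSup (hbdd _ hcm σ) i) (sub_nonneg.2 h1)
        have h4 := mul_le_mul_of_nonneg_left (le_ciSup (hbdd _ hcp σ) i) h0
        have h5 := elem (-a i t) l
        simp only [hF, hG]
        linarith
      refine (Finset.expect_le_expect fun σ _ => step σ).trans ?_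
      rw [← Finset.mul_expect]
      calc _ ≤ Real.exp (l ^ 2 / 4) * _ :=
            mul_le_mul_of_nonneg_left (expect_exp_convex G F h0 h1) (Real.exp_pos _).le
        _ ≤ _ := by
          rw [← Real.exp_add, Real.exp_le_exp]
          nlinarith [mul_le_mul_of_nonneg_left hGlog (sub_nonneg.2 h1),
            mul_le_mul_of_nonneg_left hFlog h0]
    have := two_point hp0 hq0 hU hV
    linarith

/-- Suprema of linear functions of independent signs have subgaussian upper tails. -/
lemma expect_exp_iSup_le (T : Finset ι) (a : κ → ι → ℝ) {B L : ℝ} (ha : ∀ i t, |a i t| ≤ B)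
    (hL : ∀ i, ∑ t ∈ T, a i t ^ 2 ≤ L) {l : ℝ} (hl : 0 ≤ l) :
    𝔼 σ : ι → ℤˣ, Real.exp (l * ⨆ i, ∑ t ∈ T, ((σ t : ℤ) : ℝ) * a i t)
      ≤ Real.exp (l * (𝔼 σ : ι → ℤˣ, ⨆ i, ∑ t ∈ T, ((σ t : ℤ) : ℝ) * a i t) + 4 * l ^ 2 * L) := by
  set V : (ι → ℤˣ) → ℝ := fun σ => ⨆ i, ∑ t ∈ T, ((σ t : ℤ) : ℝ) * a i t with hV
  have h := expect_exp_iSup_mul_le_one T (fun i t => l * a i t) (B := l * B)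
    (fun i t => by rw [abs_mul, abs_of_nonneg hl]; exact mul_le_mul_of_nonneg_left (ha i t) hl)
    (fun _ => 0) 0 (by simp)
  have hs : ∀ (σ : ι → ℤˣ) i, ∑ t ∈ T, ((σ t : ℤ) : ℝ) * (l * a i t)
      = l * ∑ t ∈ T, ((σ t : ℤ) : ℝ) * a i t := by
    intro σ i; rw [Finset.mul_sum]; exact Finset.sum_congr rfl fun t _ => by ring
  have hq : ∀ i, ∑ t ∈ T, (l * a i t) ^ 2 = l ^ 2 * ∑ t ∈ T, a i t ^ 2 := by
    intro i; rw [Finset.mul_sum]; exact Finset.sum_congr rfl fun t _ => by ring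
  simp only [hs, hq, zero_add, zero_sub] at h
  simp only [← Real.mul_iSup_of_nonneg hl] at h
  have hbdd : ∀ σ : ι → ℤˣ, BddAbove (Set.range fun i =>
      -(4 * (l ^ 2 * ∑ t ∈ T, a i t ^ 2)) + l * ∑ t ∈ T, ((σ t : ℤ) : ℝ) * a i t) := by
    intro σ
    refine ⟨l * (T.card * B), ?_⟩
    rintro _ ⟨i, rfl⟩
    have h1 := mul_le_mul_of_nonneg_left (abs_le.1 (abs_sum_sign_le T σ (a i) (ha i))).2 hl
    have h2 : 0 ≤ l ^ 2 * ∑ t ∈ T, a i t ^ 2 :=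
      mul_nonneg (sq_nonneg _) (Finset.sum_nonneg fun u _ => sq_nonneg _)
    simp only
    linarith
  have h1 : (𝔼 σ, Real.exp (l * V σ)) * Real.exp (-(4 * l ^ 2 * L)) ≤
      𝔼 σ : ι → ℤˣ, Real.exp (⨆ i, (-(4 * (l ^ 2 * ∑ t ∈ T, a i t ^ 2))
        + l * ∑ t ∈ T, ((σ t : ℤ) : ℝ) * a i t)) := by
    rw [Finset.expect_mul]
    refine Finset.expect_le_expect fun σ _ => ?_
    rw [← Real.exp_add, Real.exp_le_exp, hV, Real.mul_iSup_of_nonneg hl, ← le_sub_iff_add_le]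
    refine ciSup_le fun i => ?_
    have h2 := le_ciSup (hbdd σ) i
    have h3 := mul_le_mul_of_nonneg_left (hL i) (sq_nonneg l)
    linarith
  -- Jensen's inequality, by averaging the tangent line of the exponential at the mean.
  have h2 : Real.exp (-(l * 𝔼 σ, V σ)) ≤ 𝔼 σ, Real.exp (-(l * V σ)) := by
    have hpt : ∀ σ, Real.exp (-(l * 𝔼 σ, V σ)) * (1 + (l * (𝔼 σ, V σ) - l * V σ)) ≤
        Real.exp (-(l * V σ)) := by
      intro σ
      calc _ ≤ Real.exp (-(l * 𝔼 σ, V σ)) * Real.exp (l * (𝔼 σ, V σ) - l * V σ) := by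
            gcongr; linarith [Real.add_one_le_exp (l * (𝔼 σ, V σ) - l * V σ)]
        _ = _ := by rw [← Real.exp_add]; congr 1; ring
    refine le_trans (le_of_eq ?_) (Finset.expect_le_expect fun σ _ => hpt σ)
    rw [← Finset.mul_expect, Finset.expect_add_distrib, Finset.expect_sub_distrib,
      ← Finset.mul_expect (f := V)]
    simp
  set X := 𝔼 σ, Real.exp (l * V σ) with hX
  have hX0 : 0 < X := expect_exp_pos _
  have h3 : X * Real.exp (-(4 * l ^ 2 * L)) * Real.exp (-(l * 𝔼 σ, V σ)) ≤ 1 :=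
    (mul_le_mul h1 h2 (Real.exp_pos _).le (expect_exp_pos _).le).trans h
  rw [mul_assoc, ← Real.exp_add] at h3
  calc X = X * Real.exp (-(4 * l ^ 2 * L) + -(l * 𝔼 σ, V σ)) *
        Real.exp (l * (𝔼 σ, V σ) + 4 * l ^ 2 * L) := by
        rw [mul_assoc, ← Real.exp_add]; ring_nf; simp
    _ ≤ 1 * _ := by gcongr
    _ = _ := one_mul _

end Signs
end IES

namespace IES

open scoped BigOperators

/-! ### Localized complexities under random swaps of two samples -/

section Localized

variable {ι κ : Type*} [Fintype ι] [DecidableEq ι]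

/-- The unnormalized Rademacher complexity of the vectors `x i`, restricted to `T`, of squared
length at most `R`. -/
noncomputable def rad (T : Finset ι) (R : ℝ) (x : κ → ι → ℝ) : ℝ :=
  𝔼 ε : ι → ℤˣ, ⨆ i, ∑ t ∈ T, ((ε t : ℤ) : ℝ) * (if ∑ u ∈ T, x i u ^ 2 ≤ R then x i t else 0)

lemma exp_neg_le_one_sub_half {v : ℝ} (h0 : 0 ≤ v) (h1 : v ≤ 1) : Real.exp (-v) ≤ 1 - v / 2 := by
  have h : (1 + v) * Real.exp (-v) ≤ 1 := by
    calc (1 + v) * Real.exp (-v) ≤ Real.exp v * Real.exp (-v) := by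
          gcongr; linarith [Real.add_one_le_exp v]
      _ = 1 := by rw [← Real.exp_add]; simp
  have h2 : 1 ≤ (1 - v / 2) * (1 + v) := by nlinarith
  have hv : 0 < 1 + v := by linarith
  by_contra hc
  push Not at hc
  nlinarith [mul_lt_mul_of_pos_right hc hv]

/-- Each coordinate is kept independently with probability one half, and contributes the factor
`(exp(-v) + 1) / 2 ≤ 1 - v / 4 ≤ exp(-v / 4)`. -/
lemma expect_exp_neg_sum_ite_le (T : Finset ι) {v : ι → ℝ} (h0 : ∀ t, 0 ≤ v t)
    (h1 : ∀ t, v t ≤ 1) :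
    𝔼 σ : ι → ℤˣ, Real.exp (-∑ t ∈ T, if σ t = 1 then v t else 0)
      ≤ Real.exp (-(∑ t ∈ T, v t) / 4) := by
  induction T using Finset.induction_on with
  | empty => simp
  | insert t T ht ih =>
    rw [expect_update t]
    have hs : ∀ (σ : ι → ℤˣ) (e : ℤˣ),
        ∑ u ∈ insert t T, (if Function.update σ t e u = 1 then v u else 0)
          = (if e = 1 then v t else 0) + ∑ u ∈ T, if σ u = 1 then v u else 0 := by
      intro σ e
      rw [Finset.sum_insert ht]
      congr 1
      · simp
      · refine Finset.sum_congr rfl fun u hu => ?_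
        rw [Function.update_of_ne (by rintro rfl; exact ht hu)]
    simp_rw [hs]
    rw [Finset.sum_insert ht]
    have hneg : ((-1 : ℤˣ) = 1) = False := by decide
    simp only [if_true, hneg, if_false, zero_add, neg_add, Real.exp_add]
    have : ∀ y : ℝ, (Real.exp (-v t) * y + y) / 2 = ((Real.exp (-v t) + 1) / 2) * y := by
      intro y; ring
    simp_rw [this]
    rw [← Finset.mul_expect, show (-v t + -∑ u ∈ T, v u) / 4 = -v t / 4 + -(∑ u ∈ T, v u) / 4 by ring,
      Real.exp_add]
    refine mul_le_mul ?_ ih (expect_exp_pos _).le (Real.exp_pos _).le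
    have h2 := exp_neg_le_one_sub_half (h0 t) (h1 t)
    have h3 := Real.add_one_le_exp (-v t / 4)
    linarith

variable [Nonempty κ]

/-- Replacing a part of the coordinates of a class of vectors by those of another class is
unlikely to reduce its Rademacher complexity a lot. -/
lemma expect_exp_neg_mixed_le (T : Finset ι) (y z : κ → ι → ℝ) (hy : ∀ i t, |y i t| ≤ 1)
    (hz : ∀ i t, |z i t| ≤ 1) {δ : ℝ} (hδ : 0 < δ) :
    𝔼 σ : ι → ℤˣ, Real.exp (-𝔼 ε : ι → ℤˣ, ⨆ i, ∑ t ∈ T, ((ε t : ℤ) : ℝ) *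
        (if σ t = 1 then y i t else z i t))
      ≤ Real.exp (-((𝔼 ε : ι → ℤˣ, ⨆ i, ∑ t ∈ T, ((ε t : ℤ) : ℝ) * y i t) - δ) / 4) := by
  -- A near-maximizer `j τ` is fixed for each sign vector. The complexity of `y` is then, up to `δ`,
  -- the sum of the averages `w t`, a quantity that splits over coordinates and survives the removal
  -- of some of them.
  have hsel : ∀ τ : ι → ℤˣ, ∃ j, (⨆ i, ∑ t ∈ T, ((τ t : ℤ) : ℝ) * y i t) - δ
      < ∑ t ∈ T, ((τ t : ℤ) : ℝ) * y j t := fun τ =>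
    exists_lt_of_lt_ciSup (by linarith)
  choose j hj using hsel
  set w : ι → ℝ := fun t => 𝔼 τ : ι → ℤˣ, ((τ t : ℤ) : ℝ) * y (j τ) t with hw
  set u : ι → ℝ := fun t => 𝔼 τ : ι → ℤˣ, ((τ t : ℤ) : ℝ) * z (j τ) t with hu
  have hw1 : ∀ t, |w t| ≤ 1 := by
    intro t
    refine (Finset.abs_expect_le _ _).trans ?_
    simp_rw [abs_sign_mul]
    exact (Finset.expect_le_expect fun τ _ => hy (j τ) t).trans (by simp)
  have hwW : (𝔼 ε : ι → ℤˣ, ⨆ i, ∑ t ∈ T, ((ε t : ℤ) : ℝ) * y i t) - δ ≤ ∑ t ∈ T, |w t| := by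
    calc _ = 𝔼 ε : ι → ℤˣ, ((⨆ i, ∑ t ∈ T, ((ε t : ℤ) : ℝ) * y i t) - δ) := by
          rw [Finset.expect_sub_distrib]; simp
      _ ≤ 𝔼 ε : ι → ℤˣ, ∑ t ∈ T, ((ε t : ℤ) : ℝ) * y (j ε) t :=
          Finset.expect_le_expect fun ε _ => (hj ε).le
      _ = ∑ t ∈ T, w t := Finset.expect_sum_comm _ _ _
      _ ≤ _ := Finset.sum_le_sum fun t _ => le_abs_self _
  have hhalf : ∀ σ : ι → ℤˣ, ∑ t ∈ T, (if σ t = 1 then |w t| else 0) ≤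
      𝔼 ε : ι → ℤˣ, ⨆ i, ∑ t ∈ T, ((ε t : ℤ) : ℝ) * (if σ t = 1 then y i t else z i t) := by
    intro σ
    -- For the sign vector `ρ * τ` the index `j τ` is used. The extra signs `ρ` make every
    -- coordinate contribute a nonnegative amount, so the coordinates taken from `z` cannot cancel
    -- those taken from `y`; multiplication by `ρ` only permutes the sign vectors.
    set ρ : ι → ℤˣ := fun t => if 0 ≤ (if σ t = 1 then w t else u t) then 1 else -1 with hρ
    have hρabs : ∀ t, ((ρ t : ℤ) : ℝ) * (if σ t = 1 then w t else u t)
        = |if σ t = 1 then w t else u t| := by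
      intro t
      simp only [hρ]
      by_cases h : 0 ≤ (if σ t = 1 then w t else u t)
      · rw [if_pos h, abs_of_nonneg h]; simp
      · rw [if_neg h, abs_of_neg (not_le.1 h)]
        simp only [Units.val_neg, Units.val_one, Int.cast_neg, Int.cast_one, neg_mul, one_mul]
    calc ∑ t ∈ T, (if σ t = 1 then |w t| else 0)
        ≤ ∑ t ∈ T, ((ρ t : ℤ) : ℝ) * (if σ t = 1 then w t else u t) := by
          refine Finset.sum_le_sum fun t _ => ?_
          rw [hρabs]
          by_cases h : σ t = 1 <;> simp [h]
      _ = 𝔼 τ : ι → ℤˣ, ∑ t ∈ T, (((ρ * τ) t : ℤ) : ℝ) *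
            (if σ t = 1 then y (j τ) t else z (j τ) t) := by
          rw [Finset.expect_sum_comm]
          refine Finset.sum_congr rfl fun t _ => ?_
          simp only [Pi.mul_apply, Units.val_mul, Int.cast_mul, mul_assoc]
          rw [← Finset.mul_expect]
          by_cases h : σ t = 1 <;> simp [h, hw, hu]
      _ ≤ 𝔼 τ : ι → ℤˣ, ⨆ i, ∑ t ∈ T, (((ρ * τ) t : ℤ) : ℝ) *
            (if σ t = 1 then y i t else z i t) := by
          refine Finset.expect_le_expect fun τ _ => ?_
          refine le_ciSup (f := fun i => ∑ t ∈ T, (((ρ * τ) t : ℤ) : ℝ) *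
            (if σ t = 1 then y i t else z i t)) (bddAbove_of_abs_le (C := T.card * 1) fun i => ?_) (j τ)
          exact abs_sum_sign_le T _ _ fun t => by
            by_cases h : σ t = 1 <;> simp [h, hy, hz]
      _ = _ := Fintype.expect_equiv (Equiv.mulLeft ρ) _ _ fun τ => rfl
  calc _ ≤ 𝔼 σ : ι → ℤˣ, Real.exp (-∑ t ∈ T, if σ t = 1 then |w t| else 0) :=
        Finset.expect_le_expect fun σ _ => Real.exp_le_exp.2 (neg_le_neg (hhalf σ))
    _ ≤ Real.exp (-(∑ t ∈ T, |w t|) / 4) :=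
        expect_exp_neg_sum_ite_le T (fun t => abs_nonneg _) hw1
    _ ≤ _ := by gcongr

/-- The complexity of a mixture of two classes is controlled from below. -/
lemma mixed_le_rad (T : Finset ι) (R : ℝ) (x x' : κ → ι → ℝ) (hx : ∀ i t, |x i t| ≤ 1)
    (hx' : ∀ i t, |x' i t| ≤ 1) (h0 : ∃ i, ∀ t, x i t = 0 ∧ x' i t = 0) (σ : ι → ℤˣ) :
    (𝔼 ε : ι → ℤˣ, ⨆ i, ∑ t ∈ T, ((ε t : ℤ) : ℝ) * (if σ t = 1 then
        (if ∑ u ∈ T, (x i u ^ 2 + x' i u ^ 2) ≤ R then x i t else 0) else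
        (if ∑ u ∈ T, (x i u ^ 2 + x' i u ^ 2) ≤ R then x' i t else 0)))
      ≤ rad T R (fun i t => if σ t = 1 then x i t else x' i t) := by
  obtain ⟨i0, hi0⟩ := h0
  refine Finset.expect_le_expect fun ε _ => ciSup_le fun i => ?_
  have hb : BddAbove (Set.range fun i => ∑ t ∈ T, ((ε t : ℤ) : ℝ) *
      (if ∑ u ∈ T, (if σ u = 1 then x i u else x' i u) ^ 2 ≤ R then
        (if σ t = 1 then x i t else x' i t) else 0)) :=
    bddAbove_of_abs_le (C := T.card * 1) fun i => abs_sum_sign_le T _ _ fun t => by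
      split_ifs <;> simp [hx, hx']
  by_cases h : ∑ u ∈ T, (x i u ^ 2 + x' i u ^ 2) ≤ R
  · refine le_trans (le_of_eq ?_) (le_ciSup hb i)
    have h2 : ∑ u ∈ T, (if σ u = 1 then x i u else x' i u) ^ 2 ≤ R := by
      refine le_trans (Finset.sum_le_sum fun u _ => ?_) h
      split_ifs <;> nlinarith [sq_nonneg (x i u), sq_nonneg (x' i u)]
    simp only [h, h2, if_true]
  -- An index outside the joint localization contributes zero, which the zero vectors attain.
  · refine le_trans (le_of_eq ?_) (le_ciSup hb i0)
    simp [h, hi0]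

/-- Enlarging the localization by a factor multiplies the complexity by at most its root. -/
lemma expect_iSup_localized_le (T : Finset ι) (R : ℝ) (x : κ → ι → ℝ) (S : κ → ℝ)
    (hx : ∀ i t, |x i t| ≤ 1) (h0 : ∃ i, ∀ t, x i t = 0) (k : ℕ)
    (hhalf : ∀ i, ∃ j, (∀ t, x j t = x i t / 2) ∧ S j = S i / 4) :
    (𝔼 ε : ι → ℤˣ, ⨆ i, ∑ t ∈ T, ((ε t : ℤ) : ℝ) * (if S i ≤ 4 ^ k * R then x i t else 0))
      ≤ 2 ^ k * 𝔼 ε : ι → ℤˣ, ⨆ i, ∑ t ∈ T, ((ε t : ℤ) : ℝ) * (if S i ≤ R then x i t else 0) := by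
  obtain ⟨i0, hi0⟩ := h0
  have hpow : ∀ (k : ℕ) i, ∃ j, (∀ t, x i t = 2 ^ k * x j t) ∧ S i = 4 ^ k * S j := by
    intro k
    induction k with
    | zero => intro i; exact ⟨i, by simp, by simp⟩
    | succ k ih =>
      intro i
      obtain ⟨j, hj, hj'⟩ := ih i
      obtain ⟨l, hl, hl'⟩ := hhalf j
      exact ⟨l, fun t => by rw [hj, hl]; ring, by rw [hj', hl']; ring⟩
  rw [Finset.mul_expect]
  refine Finset.expect_le_expect fun ε _ => ciSup_le fun i => ?_
  have hb : BddAbove (Set.range fun i => ∑ t ∈ T, ((ε t : ℤ) : ℝ) *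
      (if S i ≤ R then x i t else 0)) :=
    bddAbove_of_abs_le (C := T.card * 1) fun i => abs_sum_sign_le T _ _ fun t => by
      split_ifs <;> simp [hx]
  by_cases h : S i ≤ 4 ^ k * R
  · obtain ⟨j, hj, hj'⟩ := hpow k i
    have h2 : S j ≤ R := by
      rw [hj'] at h
      exact le_of_mul_le_mul_left h (by positivity)
    refine le_trans (le_of_eq ?_) (mul_le_mul_of_nonneg_left (le_ciSup hb j) (by positivity))
    simp only [h, h2, if_true, Finset.mul_sum]
    exact Finset.sum_congr rfl fun t _ => by rw [hj]; ring
  · refine le_trans (le_of_eq ?_) (mul_le_mul_of_nonneg_left (le_ciSup hb i0) (by positivity))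
    simp [h, hi0]

/-- The complexity, localized at `2 * 4 ^ 12 * R`, of transformed differences is small if both
complexities localized at `R` are. -/
lemma expect_iSup_diff_le (T : Finset ι) (R : ℝ) (x x' : κ → ι → ℝ) (φ : ℝ → ℝ) (hR : 0 < R)
    (hx : ∀ i t, |x i t| ≤ 1) (hx' : ∀ i t, |x' i t| ≤ 1)
    (h0 : ∃ i, ∀ t, x i t = 0 ∧ x' i t = 0)
    (hhalf : ∀ i, ∃ j, ∀ t, x j t = x i t / 2 ∧ x' j t = x' i t / 2)
    (hφ0 : φ 0 = 0) (hφ : ∀ a b : ℝ, |a| ≤ 1 → |b| ≤ 1 → |φ a - φ b| ≤ 2 * |a - b|)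
    (h1 : 𝔼 ε : ι → ℤˣ, ⨆ i, ∑ t ∈ T, ((ε t : ℤ) : ℝ) *
      (if ∑ u ∈ T, (x i u ^ 2 + x' i u ^ 2) ≤ R then x i t else 0) ≤ 9 * R)
    (h2 : 𝔼 ε : ι → ℤˣ, ⨆ i, ∑ t ∈ T, ((ε t : ℤ) : ℝ) *
      (if ∑ u ∈ T, (x i u ^ 2 + x' i u ^ 2) ≤ R then x' i t else 0) ≤ 9 * R) :
    𝔼 ε : ι → ℤˣ, ⨆ i, ∑ t ∈ T, ((ε t : ℤ) : ℝ) *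
      (if ∑ u ∈ T, (x i u ^ 2 + x' i u ^ 2) ≤ 2 * 4 ^ 12 * R then φ (x i t) - φ (x' i t) else 0)
      ≤ 2 ^ 19 * R := by
  set S : κ → ℝ := fun i => ∑ u ∈ T, (x i u ^ 2 + x' i u ^ 2) with hS
  have hSh : ∀ i j, (∀ t, x j t = x i t / 2 ∧ x' j t = x' i t / 2) → S j = S i / 4 := by
    intro i j h
    simp only [hS, Finset.sum_div]
    exact Finset.sum_congr rfl fun u _ => by rw [(h u).1, (h u).2]; ring
  have hone : ∀ z : κ → ι → ℝ, (∀ i t, |z i t| ≤ 1) → (∃ i, ∀ t, z i t = 0) →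
      (∀ i, ∃ j, (∀ t, z j t = z i t / 2) ∧ S j = S i / 4) →
      (𝔼 ε : ι → ℤˣ, ⨆ i, ∑ t ∈ T, ((ε t : ℤ) : ℝ) * (if S i ≤ R then z i t else 0)) ≤ 9 * R →
      ∀ ψ : ℝ → ℝ, ψ 0 = 0 → (∀ a b : ℝ, |a| ≤ 1 → |b| ≤ 1 → |ψ a - ψ b| ≤ 2 * |a - b|) →
      (𝔼 ε : ι → ℤˣ, ⨆ i, ∑ t ∈ T, ((ε t : ℤ) : ℝ) *
        ψ (if S i ≤ 2 * 4 ^ 12 * R then z i t else 0)) ≤ 2 ^ 14 * (9 * R) := by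
    intro z hz hz0 hzh hzR ψ hψ0 hψ
    have hm : ∀ i t, |if S i ≤ 2 * 4 ^ 12 * R then z i t else 0| ≤ 1 := by
      intro i t; split_ifs <;> simp [hz]
    have hc := expect_iSup_contraction T
      (fun i t => ψ (if S i ≤ 2 * 4 ^ 12 * R then z i t else 0))
      (fun i t => 2 * (if S i ≤ 2 * 4 ^ 12 * R then z i t else 0)) (B := 2)
      (fun i t => by
        have := hψ _ 0 (hm i t) (by simp)
        rw [hψ0, sub_zero, sub_zero] at this
        linarith [hm i t])
      (fun i t => by rw [abs_mul, abs_two]; linarith [hm i t])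
      (fun i j t => by
        rw [← mul_sub, abs_mul, abs_two]; exact hψ _ _ (hm i t) (hm j t)) (fun _ => 0) 0 (by simp)
    simp only [zero_add] at hc
    refine hc.trans ?_
    -- Thirteen halvings suffice because `2 * 4 ^ 12 ≤ 4 ^ 13`.
    have hloc := expect_iSup_localized_le T R z S hz hz0 13 hzh
    have hle : ∀ ε : ι → ℤˣ, ⨆ i, ∑ t ∈ T, ((ε t : ℤ) : ℝ) *
          (2 * (if S i ≤ 2 * 4 ^ 12 * R then z i t else 0)) ≤
        2 * ⨆ i, ∑ t ∈ T, ((ε t : ℤ) : ℝ) * (if S i ≤ 4 ^ 13 * R then z i t else 0) := by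
      intro ε
      have hb : BddAbove (Set.range fun i => ∑ t ∈ T, ((ε t : ℤ) : ℝ) *
          (if S i ≤ 4 ^ 13 * R then z i t else 0)) :=
        bddAbove_of_abs_le (C := T.card * 1) fun i => abs_sum_sign_le T _ _ fun t => by
          split_ifs <;> simp [hz]
      refine ciSup_le fun i => ?_
      by_cases h : S i ≤ 2 * 4 ^ 12 * R
      · have h' : S i ≤ 4 ^ 13 * R := by linarith
        refine le_trans (le_of_eq ?_) (mul_le_mul_of_nonneg_left (le_ciSup hb i) zero_le_two)
        simp only [h, h', if_true, Finset.mul_sum]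
        exact Finset.sum_congr rfl fun t _ => by ring
      · obtain ⟨i0, hi0⟩ := hz0
        refine le_trans (le_of_eq ?_) (mul_le_mul_of_nonneg_left (le_ciSup hb i0) zero_le_two)
        simp [h, hi0]
    calc _ ≤ 𝔼 ε : ι → ℤˣ, 2 * ⨆ i, ∑ t ∈ T, ((ε t : ℤ) : ℝ) *
          (if S i ≤ 4 ^ 13 * R then z i t else 0) := Finset.expect_le_expect fun ε _ => hle ε
      _ ≤ 2 * (2 ^ 13 * (9 * R)) := by
          rw [← Finset.mul_expect]
          linarith
      _ = _ := by ring
  have k1 := hone x hx (h0.imp fun i h t => (h t).1)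
    (fun i => (hhalf i).imp fun j h => ⟨fun t => (h t).1, hSh i j h⟩) h1 φ hφ0 hφ
  have k2 := hone x' hx' (h0.imp fun i h t => (h t).2)
    (fun i => (hhalf i).imp fun j h => ⟨fun t => (h t).2, hSh i j h⟩) h2 (fun a => -φ a)
    (by simp [hφ0]) (fun a b ha hb => by
      rw [neg_sub_neg, abs_sub_comm]; exact hφ a b ha hb)
  have hφb : ∀ a : ℝ, |a| ≤ 1 → |φ a| ≤ 2 := by
    intro a ha
    have := hφ a 0 ha (by simp)
    rw [hφ0, sub_zero, sub_zero] at this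
    linarith
  have hb : ∀ (z : κ → ι → ℝ), (∀ i t, |z i t| ≤ 1) → ∀ ε : ι → ℤˣ, ∀ i,
      |∑ t ∈ T, ((ε t : ℤ) : ℝ) * φ (if S i ≤ 2 * 4 ^ 12 * R then z i t else 0)| ≤ T.card * 2 := by
    intro z hz ε i
    exact abs_sum_sign_le T _ _ fun t => hφb _ (by split_ifs <;> simp [hz])
  calc _ ≤ 𝔼 ε : ι → ℤˣ, ((⨆ i, ∑ t ∈ T, ((ε t : ℤ) : ℝ) *
          φ (if S i ≤ 2 * 4 ^ 12 * R then x i t else 0)) +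
        ⨆ i, ∑ t ∈ T, ((ε t : ℤ) : ℝ) *
          -φ (if S i ≤ 2 * 4 ^ 12 * R then x' i t else 0)) := by
        refine Finset.expect_le_expect fun ε _ => ciSup_le fun i => ?_
        refine le_trans (le_of_eq ?_) (add_le_add
          (le_ciSup (bddAbove_of_abs_le (hb x hx ε)) i)
          (le_ciSup (f := fun i => ∑ t ∈ T, ((ε t : ℤ) : ℝ) *
            -φ (if S i ≤ 2 * 4 ^ 12 * R then x' i t else 0))
            (bddAbove_of_abs_le (C := T.card * 2) fun i => ?_) i))
        · rw [← Finset.sum_add_distrib]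
          refine Finset.sum_congr rfl fun t _ => ?_
          split_ifs
          · ring
          · rw [hφ0]; ring
        · simp only [mul_neg, Finset.sum_neg_distrib, abs_neg]
          exact hb x' hx' ε i
    _ ≤ 2 ^ 14 * (9 * R) + 2 ^ 14 * (9 * R) := by
        rw [Finset.expect_add_distrib]; exact add_le_add k1 k2
    _ ≤ _ := by linarith

/-- Large transformed differences are unlikely under random swaps if the complexities are small. -/
lemma expect_diff_tail_le (T : Finset ι) (R : ℝ) (x x' : κ → ι → ℝ) (φ : ℝ → ℝ) (hR : 0 < R)
    (hx : ∀ i t, |x i t| ≤ 1) (hx' : ∀ i t, |x' i t| ≤ 1)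
    (h0 : ∃ i, ∀ t, x i t = 0 ∧ x' i t = 0)
    (hhalf : ∀ i, ∃ j, ∀ t, x j t = x i t / 2 ∧ x' j t = x' i t / 2)
    (hφ0 : φ 0 = 0) (hφ : ∀ a b : ℝ, |a| ≤ 1 → |b| ≤ 1 → |φ a - φ b| ≤ 2 * |a - b|)
    (h1 : 𝔼 ε : ι → ℤˣ, ⨆ i, ∑ t ∈ T, ((ε t : ℤ) : ℝ) *
      (if ∑ u ∈ T, (x i u ^ 2 + x' i u ^ 2) ≤ R then x i t else 0) ≤ 9 * R)
    (h2 : 𝔼 ε : ι → ℤˣ, ⨆ i, ∑ t ∈ T, ((ε t : ℤ) : ℝ) *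
      (if ∑ u ∈ T, (x i u ^ 2 + x' i u ^ 2) ≤ R then x' i t else 0) ≤ 9 * R) :
    𝔼 σ : ι → ℤˣ, Set.indicator {σ : ι → ℤˣ | ∃ i, ∑ u ∈ T, (x i u ^ 2 + x' i u ^ 2) ≤ 2 * 4 ^ 12 * R ∧
      2 ^ 20 * R ≤ ∑ t ∈ T, ((σ t : ℤ) : ℝ) * (φ (x i t) - φ (x' i t))} 1 σ ≤ Real.exp (-R) := by
  set S : κ → ℝ := fun i => ∑ u ∈ T, (x i u ^ 2 + x' i u ^ 2) with hS
  set d : κ → ι → ℝ := fun i t => if S i ≤ 2 * 4 ^ 12 * R then φ (x i t) - φ (x' i t) else 0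
  have hd : ∀ i t, |d i t| ≤ 4 := by
    intro i t
    simp only [d]
    split_ifs
    · refine (hφ _ _ (hx i t) (hx' i t)).trans ?_
      linarith [abs_sub (x i t) (x' i t), hx i t, hx' i t]
    · simp
  have hL : ∀ i, ∑ t ∈ T, d i t ^ 2 ≤ 16 * 4 ^ 12 * R := by
    intro i
    by_cases h : S i ≤ 2 * 4 ^ 12 * R
    · calc ∑ t ∈ T, d i t ^ 2 ≤ ∑ t ∈ T, 8 * (x i t ^ 2 + x' i t ^ 2) := by
            refine Finset.sum_le_sum fun t _ => ?_
            simp only [d, if_pos h]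
            have := pow_le_pow_left₀ (abs_nonneg _) (hφ _ _ (hx i t) (hx' i t)) 2
            rw [mul_pow, sq_abs, sq_abs] at this
            nlinarith [sq_nonneg (x i t + x' i t)]
        _ = 8 * S i := by rw [← Finset.mul_sum]
        _ ≤ _ := by linarith
    · simp only [d, if_neg h]
      simp; positivity
  have hE : 𝔼 σ : ι → ℤˣ, ⨆ i, ∑ t ∈ T, ((σ t : ℤ) : ℝ) * d i t ≤ 2 ^ 19 * R :=
    expect_iSup_diff_le T R x x' φ hR hx hx' h0 hhalf hφ0 hφ h1 h2
  -- With `l = 2⁻¹²` the mean contributes `128 R`, the variance term `64 R` and the threshold `-256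
  -- R` to the exponent, which leaves more than the required `-R`.
  have hexp := expect_exp_iSup_le T d hd hL (l := 1 / 4096) (by norm_num)
  have hpt : ∀ σ : ι → ℤˣ, Set.indicator {σ : ι → ℤˣ | ∃ i, S i ≤ 2 * 4 ^ 12 * R ∧
      2 ^ 20 * R ≤ ∑ t ∈ T, ((σ t : ℤ) : ℝ) * (φ (x i t) - φ (x' i t))} 1 σ ≤
      Real.exp (1 / 4096 * ⨆ i, ∑ t ∈ T, ((σ t : ℤ) : ℝ) * d i t) *
        Real.exp (-(1 / 4096 * (2 ^ 20 * R))) := by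
    intro σ
    refine Set.indicator_apply_le' ?_ fun _ => by positivity
    rintro ⟨i, hi, hi'⟩
    rw [← Real.exp_add, Pi.one_apply]
    refine Real.one_le_exp ?_
    have hb : BddAbove (Set.range fun i => ∑ t ∈ T, ((σ t : ℤ) : ℝ) * d i t) :=
      bddAbove_of_abs_le fun i => abs_sum_sign_le T _ _ (hd i)
    have := le_ciSup hb i
    simp only [d, if_pos hi] at this
    linarith
  refine (Finset.expect_le_expect fun σ _ => hpt σ).trans ?_
  rw [← Finset.expect_mul]
  calc _ ≤ _ := mul_le_mul_of_nonneg_right hexp (Real.exp_pos _).le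
    _ ≤ _ := by
      rw [← Real.exp_add, Real.exp_le_exp]
      linarith

/-- The tail bound for random swaps of two samples: if the class has small complexity on the first
of the swapped samples, then large transformed differences are unlikely. -/
lemma expect_swap_tail_le (T : Finset ι) (R : ℝ) (x x' : κ → ι → ℝ) (φ : ℝ → ℝ) (hR : 0 < R)
    (hx : ∀ i t, |x i t| ≤ 1) (hx' : ∀ i t, |x' i t| ≤ 1)
    (h0 : ∃ i, ∀ t, x i t = 0 ∧ x' i t = 0)
    (hhalf : ∀ i, ∃ j, ∀ t, x j t = x i t / 2 ∧ x' j t = x' i t / 2)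
    (hφ0 : φ 0 = 0) (hφ : ∀ a b : ℝ, |a| ≤ 1 → |b| ≤ 1 → |φ a - φ b| ≤ 2 * |a - b|) :
    𝔼 σ : ι → ℤˣ, Set.indicator {σ : ι → ℤˣ |
      rad T R (fun i t => if σ t = 1 then x i t else x' i t) ≤ R ∧
      ∃ i, ∑ u ∈ T, (x i u ^ 2 + x' i u ^ 2) ≤ 2 * 4 ^ 12 * R ∧
      2 ^ 20 * R ≤ |∑ t ∈ T, ((σ t : ℤ) : ℝ) * (φ (x i t) - φ (x' i t))|} 1 σ
      ≤ 2 * Real.exp (-R) := by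
  set S : κ → ℝ := fun i => ∑ u ∈ T, (x i u ^ 2 + x' i u ^ 2) with hS
  set y : κ → ι → ℝ := fun i t => if S i ≤ R then x i t else 0 with hy
  set z : κ → ι → ℝ := fun i t => if S i ≤ R then x' i t else 0 with hz
  have hy1 : ∀ i t, |y i t| ≤ 1 := by intro i t; simp only [y]; split_ifs <;> simp [hx]
  have hz1 : ∀ i t, |z i t| ≤ 1 := by intro i t; simp only [z]; split_ifs <;> simp [hx']
  set W : (ι → ℤˣ) → ℝ := fun σ => 𝔼 ε : ι → ℤˣ, ⨆ i, ∑ t ∈ T, ((ε t : ℤ) : ℝ) *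
    (if σ t = 1 then y i t else z i t) with hW
  have hWrad : ∀ σ, W σ ≤ rad T R (fun i t => if σ t = 1 then x i t else x' i t) :=
    mixed_le_rad T R x x' hx hx' h0
  -- Markov's inequality for `exp(-W)`: the complexity condition alone forces `W σ ≤ R`, so large
  -- differences play no role in this case.
  have hbig : 𝔼 σ, Real.exp (-W σ) ≤ Real.exp (-(2 * R)) → 𝔼 σ : ι → ℤˣ, Set.indicator
      {σ : ι → ℤˣ | rad T R (fun i t => if σ t = 1 then x i t else x' i t) ≤ R ∧
      ∃ i, S i ≤ 2 * 4 ^ 12 * R ∧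
      2 ^ 20 * R ≤ |∑ t ∈ T, ((σ t : ℤ) : ℝ) * (φ (x i t) - φ (x' i t))|} 1 σ
      ≤ 2 * Real.exp (-R) := by
    intro h
    have hpt : ∀ σ : ι → ℤˣ, Set.indicator {σ : ι → ℤˣ |
        rad T R (fun i t => if σ t = 1 then x i t else x' i t) ≤ R ∧
        ∃ i, S i ≤ 2 * 4 ^ 12 * R ∧
        2 ^ 20 * R ≤ |∑ t ∈ T, ((σ t : ℤ) : ℝ) * (φ (x i t) - φ (x' i t))|} 1 σ
        ≤ Real.exp R * Real.exp (-W σ) := by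
      intro σ
      refine Set.indicator_apply_le' ?_ fun _ => by positivity
      rintro ⟨h', -⟩
      rw [← Real.exp_add, Pi.one_apply]
      exact Real.one_le_exp (by linarith [hWrad σ])
    refine (Finset.expect_le_expect fun σ _ => hpt σ).trans ?_
    rw [← Finset.mul_expect]
    calc _ ≤ Real.exp R * Real.exp (-(2 * R)) := by gcongr
      _ = Real.exp (-R) := by rw [← Real.exp_add]; ring_nf
      _ ≤ _ := by linarith [Real.exp_pos (-R)]
  -- The dichotomy concerns quantities that do not depend on the swap `σ`. The constant 9 is such
  -- that the slack `δ = R` leaves `(9R - R) / 4 = 2R` in the exponent, as `hbig` demands.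
  by_cases h1 : 𝔼 ε : ι → ℤˣ, ⨆ i, ∑ t ∈ T, ((ε t : ℤ) : ℝ) * y i t ≤ 9 * R
  · by_cases h2 : 𝔼 ε : ι → ℤˣ, ⨆ i, ∑ t ∈ T, ((ε t : ℤ) : ℝ) * z i t ≤ 9 * R
    · have k1 := expect_diff_tail_le T R x x' φ hR hx hx' h0 hhalf hφ0 hφ h1 h2
      have k2 := expect_diff_tail_le T R x x' (fun a => -φ a) hR hx hx' h0 hhalf (by simp [hφ0])
        (fun a b ha hb => by rw [neg_sub_neg, abs_sub_comm]; exact hφ a b ha hb) h1 h2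
      rw [two_mul (Real.exp (-R))]
      refine le_trans ?_ (add_le_add k1 k2)
      rw [← Finset.expect_add_distrib]
      refine Finset.expect_le_expect fun σ _ => ?_
      have hn1 := Set.indicator_nonneg (s := {σ : ι → ℤˣ | ∃ i, S i ≤ 2 * 4 ^ 12 * R ∧
        2 ^ 20 * R ≤ ∑ t ∈ T, ((σ t : ℤ) : ℝ) * (φ (x i t) - φ (x' i t))})
        (f := (1 : (ι → ℤˣ) → ℝ)) (fun _ _ => zero_le_one) σ
      have hn2 := Set.indicator_nonneg (s := {σ : ι → ℤˣ | ∃ i, S i ≤ 2 * 4 ^ 12 * R ∧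
        2 ^ 20 * R ≤ ∑ t ∈ T, ((σ t : ℤ) : ℝ) * (-φ (x i t) - -φ (x' i t))})
        (f := (1 : (ι → ℤˣ) → ℝ)) (fun _ _ => zero_le_one) σ
      refine Set.indicator_apply_le' ?_ fun _ => add_nonneg hn1 hn2
      rintro ⟨-, i, hi, hi'⟩
      rcases le_abs.1 hi' with h | h
      · rw [Set.indicator_of_mem (s := {σ : ι → ℤˣ | ∃ i, S i ≤ 2 * 4 ^ 12 * R ∧
          2 ^ 20 * R ≤ ∑ t ∈ T, ((σ t : ℤ) : ℝ) * (φ (x i t) - φ (x' i t))}) ⟨i, hi, h⟩]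
        exact le_add_of_nonneg_right hn2
      · rw [Set.indicator_of_mem (s := {σ : ι → ℤˣ | ∃ i, S i ≤ 2 * 4 ^ 12 * R ∧
          2 ^ 20 * R ≤ ∑ t ∈ T, ((σ t : ℤ) : ℝ) * (-φ (x i t) - -φ (x' i t))}) ⟨i, hi, by
            refine h.trans (le_of_eq ?_)
            rw [← Finset.sum_neg_distrib]
            exact Finset.sum_congr rfl fun t _ => by ring⟩]
        exact le_add_of_nonneg_left hn1
    · refine hbig ?_
      push Not at h2
      -- The coordinates of `z` are those with negative sign; replacing `σ` by `-σ` exchanges the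
      -- two roles.
      have k := expect_exp_neg_mixed_le T z y hz1 hy1 hR
      refine le_trans (le_of_eq ?_) (k.trans (Real.exp_le_exp.2 (by linarith)))
      refine Fintype.expect_equiv (Equiv.neg _) _ _ fun σ => ?_
      simp only [hW, Equiv.neg_apply, Pi.neg_apply]
      have h' : ∀ i t, (if σ t = 1 then y i t else z i t) = if -σ t = 1 then z i t else y i t := by
        intro i t
        rcases Int.units_eq_one_or (σ t) with h | h
        · rw [h, if_pos rfl, if_neg (by decide)]
        · rw [h, if_neg (by decide), if_pos (by decide)]
      simp only [h']
  · refine hbig ?_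
    push Not at h1
    have k := expect_exp_neg_mixed_le T y z hy1 hz1 hR
    exact k.trans (Real.exp_le_exp.2 (by linarith))

end Localized
end IES

namespace IES

open scoped BigOperators
open ProbabilityTheory

/-! ### Symmetrization by a ghost sample and by swaps -/

section Swap

variable {ι Ω : Type*} [Fintype ι] [DecidableEq ι] [MeasurableSpace Ω]

/-- Exchange of the coordinates with negative sign of two samples. -/
def swapSample (σ : ι → ℤˣ) (p : (ι → Ω) × (ι → Ω)) : (ι → Ω) × (ι → Ω) :=
  (fun t => if σ t = 1 then p.1 t else p.2 t, fun t => if σ t = 1 then p.2 t else p.1 t)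

omit [DecidableEq ι] in
lemma measurePreserving_swapSample (ν : ι → Measure Ω) [∀ t, IsProbabilityMeasure (ν t)]
    (σ : ι → ℤˣ) : MeasurePreserving (swapSample σ) ((Measure.pi ν).prod (Measure.pi ν))
      ((Measure.pi ν).prod (Measure.pi ν)) := by
  have he := measurePreserving_arrowProdEquivProdArrow Ω Ω ι ν ν
  let c : ι → Ω × Ω → Ω × Ω := fun t => if σ t = 1 then id else Prod.swap
  have hc : ∀ t, MeasurePreserving (c t) ((ν t).prod (ν t)) ((ν t).prod (ν t)) := by
    intro t
    by_cases h : σ t = 1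
    · simp only [c, h, if_true]; exact MeasurePreserving.id _
    · simp only [c, h, if_false]; exact Measure.measurePreserving_swap
  have hpi : MeasurePreserving (fun (p : ι → Ω × Ω) t => c t (p t))
      (Measure.pi fun t => (ν t).prod (ν t)) (Measure.pi fun t => (ν t).prod (ν t)) := by
    refine ⟨measurable_pi_lambda _ fun t => (hc t).measurable.comp (measurable_pi_apply t), ?_⟩
    have := fun t => (hc t).map_eq
    rw [Measure.pi_map_pi (fun t => (hc t).measurable.aemeasurable)]
    simp_rw [this]
  have hall := he.comp (hpi.comp (he.symm _))
  convert hall using 1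
  funext p
  refine Prod.ext ?_ ?_ <;> funext t <;> by_cases h : σ t = 1 <;>
    simp [swapSample, c, h, MeasurableEquiv.arrowProdEquivProdArrow, Equiv.arrowProdEquivProdArrow]

/-- Symmetrization by random swaps: an event is as likely as under the worst pair of samples. -/
lemma prod_le_of_forall_swap (ν : ι → Measure Ω) [∀ t, IsProbabilityMeasure (ν t)]
    {S : Set ((ι → Ω) × (ι → Ω))} (hS : MeasurableSet S) {c : ℝ}
    (h : ∀ p, 𝔼 σ : ι → ℤˣ, Set.indicator {σ | swapSample σ p ∈ S} 1 σ ≤ c) :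
    ((Measure.pi ν).prod (Measure.pi ν)) S ≤ ENNReal.ofReal c := by
  set P := (Measure.pi ν).prod (Measure.pi ν) with hP
  have hreal : P.real S ≤ c := by
    have h1 : ∀ σ : ι → ℤˣ, P.real S = ∫ p, Set.indicator (swapSample σ ⁻¹' S) 1 p ∂P := by
      intro σ
      rw [integral_indicator_one ((measurePreserving_swapSample ν σ).measurable hS)]
      simp only [Measure.real, (measurePreserving_swapSample ν σ).measure_preimage
        hS.nullMeasurableSet, hP]
    have hint : ∀ σ : ι → ℤˣ, Integrable (fun p => Set.indicator (swapSample σ ⁻¹' S)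
        (1 : (ι → Ω) × (ι → Ω) → ℝ) p) P := fun σ =>
      (integrable_const (1 : ℝ)).indicator ((measurePreserving_swapSample ν σ).measurable hS)
    calc P.real S = 𝔼 σ : ι → ℤˣ, ∫ p, Set.indicator (swapSample σ ⁻¹' S) (1 : (ι → Ω) × (ι → Ω) → ℝ) p ∂P := by
          rw [← Finset.expect_congr rfl fun σ _ => h1 σ]; simp
      _ = ∫ p, 𝔼 σ : ι → ℤˣ, Set.indicator (swapSample σ ⁻¹' S) (1 : (ι → Ω) × (ι → Ω) → ℝ) p ∂P := by
          simp_rw [Fintype.expect_eq_sum_div_card]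
          rw [integral_div, integral_finsetSum _ fun σ _ => hint σ]
      _ ≤ ∫ p, c ∂P := by
          refine integral_mono_of_nonneg ?_ (integrable_const _) ?_
          · exact ae_of_all _ fun p => Finset.expect_nonneg fun σ _ =>
              Set.indicator_nonneg (fun _ _ => zero_le_one) _
          · exact ae_of_all _ fun p => h p
      _ = c := by simp
  rw [← ofReal_measureReal]
  exact ENNReal.ofReal_le_ofReal hreal

/-- Symmetrization by a ghost sample. -/
lemma measure_le_two_mul_prod (P : Measure Ω) [IsProbabilityMeasure P] {E : Set Ω}
    {S : Set (Ω × Ω)} (hS : MeasurableSet S)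
    (h : ∀ D ∈ E, 1 / 2 ≤ P (Prod.mk D ⁻¹' S)) : P E ≤ 2 * (P.prod P) S := by
  rw [Measure.prod_apply hS]
  -- Markov's inequality is applied to the section measure, which is measurable since `S` is; the
  -- set `E` need not be.
  have hm := mul_meas_ge_le_lintegral (μ := P) (measurable_measure_prodMk_left (ν := P) hS) (1 / 2)
  have hE : P E ≤ P {D | 1 / 2 ≤ P (Prod.mk D ⁻¹' S)} := measure_mono h
  calc P E = 2 * (1 / 2 * P E) := by
        rw [← mul_assoc, one_div, ENNReal.mul_inv_cancel (by simp) (by simp), one_mul]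
    _ ≤ _ := by gcongr; exact (mul_le_mul_right hE _).trans hm

end Swap

/-! ### Deviations of a single function -/

section Chebyshev

variable {ι Ω : Type*} [Fintype ι] [MeasurableSpace Ω]

/-- Chebyshev's inequality for sample averages. -/
lemma pi_empMean_deviation_le {s : Finset ι} (hs : s.Nonempty) (ν : ι → Measure Ω)
    [∀ t, IsProbabilityMeasure (ν t)] (μ : Measure Ω) [IsProbabilityMeasure μ]
    (hν : ∀ t ∈ s, ν t = μ) {g : Ω → ℝ} (hg : Measurable g) (hg1 : ∀ o, |g o| ≤ 1) {u : ℝ}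
    (hu : 0 < u) (hvar : 4 * ∫ o, g o ^ 2 ∂μ ≤ s.card * u ^ 2) :
    (Measure.pi ν) {D | u < |empMean s D g - ∫ o, g o ∂μ|} ≤ 1 / 4 := by
  have hN : (0 : ℝ) < s.card := by exact_mod_cast hs.card_pos
  set X : ι → (ι → Ω) → ℝ := fun t D => g (D t) with hX
  have hXm : ∀ t, Measurable (X t) := fun t => hg.comp (measurable_pi_apply t)
  have hX2 : ∀ t, MemLp (X t) 2 (Measure.pi ν) := fun t =>
    MemLp.of_bound (hXm t).aestronglyMeasurable 1 (ae_of_all _ fun D => hg1 _)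
  have hind : iIndepFun X (Measure.pi ν) :=
    iIndepFun_pi (μ := ν) (X := fun _ => g) (fun t => hg.aemeasurable)
  have hmean : ∫ D, (∑ t ∈ s, X t) D ∂(Measure.pi ν) = s.card * ∫ o, g o ∂μ := by
    simp only [Finset.sum_apply]
    rw [integral_finsetSum _ fun t _ => (hX2 t).integrable (by norm_num)]
    rw [Finset.sum_congr rfl fun t ht => (integral_comp_eval (μ := ν) (i := t)
      hg.aestronglyMeasurable).trans (by rw [hν t ht])]
    simp
  have hv : variance (∑ t ∈ s, X t) (Measure.pi ν) ≤ s.card * ∫ o, g o ^ 2 ∂μ := by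
    rw [IndepFun.variance_sum (fun t _ => hX2 t) fun t _ t' _ htt' => hind.indepFun htt',
      ← nsmul_eq_mul]
    refine Finset.sum_le_card_nsmul _ _ _ fun t ht => ?_
    have h1 : variance (X t) (Measure.pi ν) = variance g (ν t) :=
      (measurePreserving_eval ν t).variance_fun_comp hg.aemeasurable
    rw [h1, hν t ht]
    exact variance_le_expectation_sq hg.aestronglyMeasurable
  have hc := meas_ge_le_variance_div_sq (μ := Measure.pi ν) (memLp_finsetSum' s fun t _ => hX2 t)
    (c := s.card * u) (by positivity)
  rw [hmean] at hc
  refine (measure_mono ?_).trans (hc.trans ?_)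
  · intro D hD
    simp only [Set.mem_ofPred_eq, Finset.sum_apply, empMean] at hD ⊢
    have : ∑ t ∈ s, X t D - s.card * ∫ o, g o ∂μ
        = s.card * ((∑ t ∈ s, g (D t)) / s.card - ∫ o, g o ∂μ) := by
      simp only [hX]; field_simp
    rw [this, abs_mul, abs_of_pos hN]
    exact mul_le_mul_of_nonneg_left hD.le hN.le
  · refine ENNReal.ofReal_le_of_le_toReal ?_
    simp only [one_div, ENNReal.toReal_inv, ENNReal.toReal_ofNat]
    rw [div_le_iff₀ (by positivity)]
    nlinarith [mul_le_mul_of_nonneg_left hvar hN.le]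

end Chebyshev
end IES

namespace IES

open scoped BigOperators
open ProbabilityTheory

/-! ### From a failed concentration to a difference of two samples -/

section Ghost

variable {ι Ω : Type*}

/-- The deviations of the sample averages of `g` and `g²` are small relative to the norm of
`g`. -/
def Concentrates [MeasurableSpace Ω] (s : Finset ι) (D : ι → Ω) (μ : Measure Ω) (η : ℝ)
    (g : Ω → ℝ) : Prop :=
  |empMean s D (fun o => g o ^ 2) - ∫ o, g o ^ 2 ∂μ| ≤ 1 / 2 * (∫ o, g o ^ 2 ∂μ + η ^ 2) ∧
    |empMean s D g - ∫ o, g o ∂μ| ≤ η * (l2norm μ g + η)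

/-- The least admissible `k` works. Either no scaling is needed, or the scaled value is within a
factor four of the threshold, so that lower bounds proportional to it survive the scaling. -/
lemma exists_quarter_scale {S e : ℝ} (he : 0 < e) :
    ∃ k : ℕ, S / 4 ^ k ≤ e ∧ (k = 0 ∨ e / 4 ≤ S / 4 ^ k) := by
  classical
  have hex : ∃ k : ℕ, S / 4 ^ k ≤ e := by
    obtain ⟨k, hk⟩ := pow_unbounded_of_one_lt (S / e) (by norm_num : (1 : ℝ) < 4)
    refine ⟨k, ?_⟩
    rw [div_lt_iff₀ he] at hk
    rw [div_le_iff₀ (by positivity)]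
    linarith
  refine ⟨Nat.find hex, Nat.find_spec hex, ?_⟩
  rcases h : Nat.find hex with _ | k
  · exact Or.inl rfl
  · right
    have := Nat.find_min hex (m := k) (by omega)
    push Not at this
    rw [pow_succ, ← div_div]
    linarith

/-- If an average deviates from its mean and those of an independent sample do not, then a scaled
copy has a large difference between the two samples. -/
lemma exists_scale_of_deviation {p p' m m' v q a η : ℝ} (hη : 0 < η)
    (ha : 0 ≤ a) (hav : a ^ 2 = v)
    (hdev : ¬ (|p - v| ≤ 1 / 2 * (v + η ^ 2) ∧ |m - q| ≤ η * (a + η)))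
    (h1 : |p' - v| ≤ 1 / 8 * (v + η ^ 2)) (h2 : |m' - q| ≤ 1 / 2 * (η * (a + η))) :
    ∃ k : ℕ, (p + p') / 4 ^ k ≤ 2 * η ^ 2 ∧
      (η ^ 2 / 16 ≤ |m - m'| / 2 ^ k ∨ η ^ 2 / 16 ≤ |p - p'| / 4 ^ k) := by
  obtain ⟨k, hk, hk'⟩ := exists_quarter_scale (S := p + p') (e := 2 * η ^ 2) (by positivity)
  have h4 : (0 : ℝ) < 4 ^ k := by positivity
  have hη2 : 0 < η ^ 2 := by positivity
  refine ⟨k, hk, ?_⟩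
  have hv : 0 ≤ v := hav ▸ sq_nonneg a
  rw [abs_le] at h1
  by_cases hA : |p - v| ≤ 1 / 2 * (v + η ^ 2)
  · left
    have hB : η * (a + η) < |m - q| := by
      by_contra h; exact hdev ⟨hA, not_lt.1 h⟩
    have he : 1 / 2 * (η * (a + η)) ≤ |m - m'| := by
      have := abs_sub_le m m' q
      linarith
    rw [abs_le] at hA
    -- Here `p ≤ 3v/2 + η²/2` and `p' ≤ 9v/8 + η²/8`. The joint second moment is thus controlled by
    -- the same `(a + η)²` that bounds the difference of means from below, and the ratio is
    -- unaffected by the scaling.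
    have hS : p + p' ≤ 21 / 8 * (a + η) ^ 2 := by nlinarith
    rcases hk' with rfl | hk'
    · rw [pow_zero, div_one]; nlinarith
    · refine le_of_sq_le_sq ?_ (by positivity)
      have h24 : ((2 : ℝ) ^ k) ^ 2 = 4 ^ k := by rw [← pow_mul, mul_comm, pow_mul]; norm_num
      rw [div_pow |m - m'|, h24]
      have h5 : (1 / 2 * (η * (a + η))) ^ 2 ≤ |m - m'| ^ 2 :=
        pow_le_pow_left₀ (by positivity) he 2
      have h6 : 2 / 21 * η ^ 2 * (p + p') ≤ |m - m'| ^ 2 := by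
        refine le_trans ?_ h5
        nlinarith [mul_le_mul_of_nonneg_left hS hη2.le]
      calc (η ^ 2 / 16) ^ 2 ≤ 2 / 21 * η ^ 2 * (2 * η ^ 2 / 4) := by nlinarith [sq_nonneg (η ^ 2)]
        _ ≤ 2 / 21 * η ^ 2 * ((p + p') / 4 ^ k) := by gcongr
        _ = 2 / 21 * η ^ 2 * (p + p') / 4 ^ k := by ring
        _ ≤ _ := by gcongr
  · right
    push Not at hA
    have hd : 3 / 8 * (v + η ^ 2) ≤ |p - p'| := by
      have := abs_sub_le p p' v
      have h3 : |p' - v| ≤ 1 / 8 * (v + η ^ 2) := abs_le.2 h1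
      linarith
    rcases hk' with rfl | hk'
    · rw [pow_zero, div_one]; linarith
    -- From `p + p' ≤ |p - p'| + 2p'` and `2p' ≤ 9/4 * (v + η²) ≤ 6 * |p - p'|`.
    · have h6 : 1 / 7 * (p + p') ≤ |p - p'| := by
        have := le_abs_self (p - p')
        linarith
      calc η ^ 2 / 16 ≤ 1 / 7 * (2 * η ^ 2 / 4) := by linarith
        _ ≤ 1 / 7 * ((p + p') / 4 ^ k) := by gcongr
        _ = 1 / 7 * (p + p') / 4 ^ k := by ring
        _ ≤ _ := by gcongr

end Ghost

/-! ### Concentration at a fixed radius -/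

section FixedRadius

variable {ι κ Ω : Type*} [Fintype ι] [DecidableEq ι] [MeasurableSpace Ω] [Countable κ]

lemma measurable_rad (T : Finset ι) (R : ℝ) {f : κ → Ω → ℝ} (hf : ∀ i, Measurable (f i)) :
    Measurable fun D : ι → Ω => rad T R (fun i t => f i (D t)) := by
  unfold rad
  simp_rw [Fintype.expect_eq_sum_div_card]
  refine (Finset.measurable_sum _ fun ε _ => Measurable.iSup fun i =>
    Finset.measurable_sum _ fun t _ => Measurable.const_mul (Measurable.ite ?_ ?_ measurable_const) _).div_const _
  · exact measurableSet_le (Finset.measurable_sum _ fun u _ =>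
      ((hf i).comp (measurable_pi_apply u)).pow_const 2) measurable_const
  · exact (hf i).comp (measurable_pi_apply t)

/-- Pairs of samples for which the class has small complexity on the first one and a function of
the class has a large difference between them. -/
def swapEvent (f : κ → Ω → ℝ) (s : Finset ι) (R : ℝ) (φ : ℝ → ℝ) : Set ((ι → Ω) × (ι → Ω)) :=
  {p | rad s R (fun i t => f i (p.1 t)) ≤ R ∧
    ∃ i, ∑ t ∈ s, (f i (p.1 t) ^ 2 + f i (p.2 t) ^ 2) ≤ 2 * 4 ^ 12 * R ∧
      2 ^ 20 * R ≤ |∑ t ∈ s, (φ (f i (p.1 t)) - φ (f i (p.2 t)))|}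

lemma measurableSet_swapEvent {f : κ → Ω → ℝ} (hf : ∀ i, Measurable (f i)) (s : Finset ι) (R : ℝ)
    {φ : ℝ → ℝ} (hφ : Measurable φ) : MeasurableSet (swapEvent f s R φ) := by
  have hm1 : ∀ i t, Measurable fun p : (ι → Ω) × (ι → Ω) => f i (p.1 t) := fun i t =>
    (hf i).comp ((measurable_pi_apply t).comp measurable_fst)
  have hm2 : ∀ i t, Measurable fun p : (ι → Ω) × (ι → Ω) => f i (p.2 t) := fun i t =>
    (hf i).comp ((measurable_pi_apply t).comp measurable_snd)
  have heq : swapEvent f s R φ = {p | rad s R (fun i t => f i (p.1 t)) ≤ R} ∩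
      ⋃ i, ({p | ∑ t ∈ s, (f i (p.1 t) ^ 2 + f i (p.2 t) ^ 2) ≤ 2 * 4 ^ 12 * R} ∩
        {p | 2 ^ 20 * R ≤ |∑ t ∈ s, (φ (f i (p.1 t)) - φ (f i (p.2 t)))|}) := by
    ext p; simp [swapEvent]
  rw [heq]
  refine (measurableSet_le ((measurable_rad s R hf).comp measurable_fst) measurable_const).inter ?_
  refine MeasurableSet.iUnion fun i => MeasurableSet.inter ?_ ?_
  · exact measurableSet_le (Finset.measurable_sum _ fun t _ =>
      ((hm1 i t).pow_const 2).add ((hm2 i t).pow_const 2)) measurable_const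
  · exact measurableSet_le measurable_const (Measurable.abs (Finset.measurable_sum _ fun t _ =>
      (hφ.comp (hm1 i t)).sub (hφ.comp (hm2 i t))))

variable [Nonempty κ]

/-- A swap leaves the joint norm invariant, multiplies each difference by its sign and replaces the
first sample by the mixed one. For a fixed pair this is precisely the event of
`expect_swap_tail_le`. -/
lemma prod_swapEvent_le {f : κ → Ω → ℝ} (hf : ∀ i, Measurable (f i)) (hf1 : ∀ i o, |f i o| ≤ 1)
    (h0 : ∃ i, ∀ o, f i o = 0) (hhalf : ∀ i, ∃ j, ∀ o, f j o = f i o / 2) (s : Finset ι) {R : ℝ}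
    (hR : 0 < R) (ν : ι → Measure Ω) [∀ t, IsProbabilityMeasure (ν t)]
    {φ : ℝ → ℝ} (hφm : Measurable φ)
    (hφ0 : φ 0 = 0) (hφ : ∀ a b : ℝ, |a| ≤ 1 → |b| ≤ 1 → |φ a - φ b| ≤ 2 * |a - b|) :
    ((Measure.pi ν).prod (Measure.pi ν)) (swapEvent f s R φ)
      ≤ ENNReal.ofReal (2 * Real.exp (-R)) := by
  refine prod_le_of_forall_swap ν (measurableSet_swapEvent hf s R hφm) fun p => ?_
  refine le_trans (le_of_eq ?_) (expect_swap_tail_le s R (fun i t => f i (p.1 t))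
    (fun i t => f i (p.2 t)) φ hR (fun i t => hf1 _ _) (fun i t => hf1 _ _)
    (h0.imp fun i h t => ⟨h _, h _⟩) (fun i => (hhalf i).imp fun j h t => ⟨h _, h _⟩) hφ0 hφ)
  refine Finset.expect_congr rfl fun σ _ => ?_
  congr 1
  ext σ
  simp only [swapEvent, swapSample, Set.mem_ofPred_eq]
  have e1 : ∀ i t, f i (if σ t = 1 then p.1 t else p.2 t)
      = if σ t = 1 then f i (p.1 t) else f i (p.2 t) := fun i t => by split_ifs <;> rfl
  have e3 : ∀ i t, f i (if σ t = 1 then p.1 t else p.2 t) ^ 2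
      + f i (if σ t = 1 then p.2 t else p.1 t) ^ 2 = f i (p.1 t) ^ 2 + f i (p.2 t) ^ 2 :=
    fun i t => by split_ifs <;> ring
  have e4 : ∀ i t, φ (f i (if σ t = 1 then p.1 t else p.2 t))
      - φ (f i (if σ t = 1 then p.2 t else p.1 t))
      = ((σ t : ℤ) : ℝ) * (φ (f i (p.1 t)) - φ (f i (p.2 t))) := by
    intro i t
    rcases Int.units_eq_one_or (σ t) with h | h
    · simp [h]
    · rw [h, if_neg (by decide), if_neg (by decide)]; simp
  simp only [e3, e4]
  simp only [e1]

/-- For a fixed radius with `R = N r²`, all functions of the class concentrate at scale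
`4096 r` unless the complexity at radius `r` is large. -/
lemma pi_not_concentrates_le {f : κ → Ω → ℝ} (hf : ∀ i, Measurable (f i))
    (hf1 : ∀ i o, |f i o| ≤ 1) (h0 : ∃ i, ∀ o, f i o = 0)
    (hhalf : ∀ i, ∃ j, ∀ o, f j o = f i o / 2) {s : Finset ι} (hs : s.Nonempty) {r : ℝ}
    (hr : 0 < r) (hr1 : 1 ≤ s.card * r ^ 2) (ν : ι → Measure Ω) [∀ t, IsProbabilityMeasure (ν t)]
    (μ : Measure Ω) [IsProbabilityMeasure μ] (hν : ∀ t ∈ s, ν t = μ) :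
    (Measure.pi ν) {D | rad s (s.card * r ^ 2) (fun i t => f i (D t)) ≤ s.card * r ^ 2 ∧
      ∃ i, ¬ Concentrates s D μ (4096 * r) (f i)}
      ≤ ENNReal.ofReal (8 * Real.exp (-(s.card * r ^ 2))) := by
  have hN : (0 : ℝ) < s.card := by exact_mod_cast hs.card_pos
  set R : ℝ := s.card * r ^ 2 with hR
  have hR0 : 0 < R := by linarith
  set η : ℝ := 4096 * r with hη
  have hη0 : 0 < η := by positivity
  -- Since `4096² = 4 ^ 12`, the bounds `2η²` and `η²/16` of `exists_scale_of_deviation` become,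
  -- after multiplication by the sample size, the thresholds `2 * 4 ^ 12 * R` and `2 ^ 20 * R` of
  -- `swapEvent`.
  have hηR : s.card * η ^ 2 = 4 ^ 12 * R := by rw [hη, hR]; ring
  set S := swapEvent f s R id ∪ swapEvent f s R (fun a => a ^ 2) with hS
  have hSm : MeasurableSet S := (measurableSet_swapEvent hf s R measurable_id).union
    (measurableSet_swapEvent hf s R (measurable_id.pow_const 2))
  have hhalfk : ∀ (k : ℕ) i, ∃ j, ∀ o, f j o = f i o / 2 ^ k := by
    intro k
    induction k with
    | zero => intro i; exact ⟨i, by simp⟩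
    | succ k ih =>
      intro i
      obtain ⟨j, hj⟩ := ih i
      obtain ⟨l, hl⟩ := hhalf j
      exact ⟨l, fun o => by rw [hl, hj, pow_succ, div_div]⟩
  have hghost := measure_le_two_mul_prod (Measure.pi ν) hSm
    (E := {D | rad s R (fun i t => f i (D t)) ≤ R ∧ ∃ i, ¬ Concentrates s D μ η (f i)}) (by
      rintro D ⟨hD, i, hi⟩
      set v := ∫ o, f i o ^ 2 ∂μ with hv
      have hv0 : 0 ≤ v := integral_nonneg fun o => sq_nonneg _
      set a := l2norm μ (f i) with ha
      have ha0 : 0 ≤ a := Real.sqrt_nonneg _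
      have hav : a ^ 2 = v := Real.sq_sqrt hv0
      set G1 := {D' : ι → Ω | 1 / 8 * (v + η ^ 2) < |empMean s D' (fun o => f i o ^ 2) - v|}
      set G2 := {D' : ι → Ω | 1 / 2 * (η * (a + η)) < |empMean s D' (f i) - ∫ o, f i o ∂μ|}
      have hG1 : (Measure.pi ν) G1 ≤ 1 / 4 := by
        refine pi_empMean_deviation_le hs ν μ hν ((hf i).pow_const 2) (fun o => ?_)
          (by positivity) ?_
        · rw [abs_pow]; exact pow_le_one₀ (abs_nonneg _) (hf1 i o)
        · have h4 : ∫ o, (f i o ^ 2) ^ 2 ∂μ ≤ v := by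
            refine integral_mono_of_nonneg (ae_of_all _ fun o => sq_nonneg _) ?_
              (ae_of_all _ fun o => ?_)
            · refine Integrable.of_bound ((hf i).pow_const 2).aestronglyMeasurable 1
                (ae_of_all _ fun o => ?_)
              rw [norm_pow]; exact pow_le_one₀ (norm_nonneg _) (hf1 i o)
            · have : f i o ^ 2 ≤ 1 := (sq_le_one_iff_abs_le_one _).2 (hf1 i o)
              simp only
              nlinarith [sq_nonneg (f i o)]
          -- By `(v + η²)² ≥ 4vη²`, the squared threshold is at least proportional to the variance
          -- bound `v`, and Chebyshev's inequality applies because `s.card * η ^ 2` is large.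
          have h5 : s.card * (1 / 16 * (v * η ^ 2)) ≤ s.card * (1 / 8 * (v + η ^ 2)) ^ 2 := by
            gcongr
            nlinarith [sq_nonneg (v - η ^ 2)]
          have h6 : 4 * v ≤ s.card * (1 / 16 * (v * η ^ 2)) := by
            have : s.card * (1 / 16 * (v * η ^ 2)) = 1 / 16 * v * (s.card * η ^ 2) := by ring
            rw [this, hηR]
            nlinarith
          linarith
      have hG2 : (Measure.pi ν) G2 ≤ 1 / 4 := by
        refine pi_empMean_deviation_le hs ν μ hν (hf i) (hf1 i) (by positivity) ?_
        have h5 : s.card * (1 / 4 * (v * η ^ 2)) ≤ s.card * (1 / 2 * (η * (a + η))) ^ 2 := by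
          gcongr
          rw [← hav]
          nlinarith [mul_nonneg ha0 hη0.le, mul_nonneg (mul_nonneg ha0 hη0.le) (sq_nonneg η),
            sq_nonneg (η ^ 2)]
        have h6 : 4 * v ≤ s.card * (1 / 4 * (v * η ^ 2)) := by
          have : s.card * (1 / 4 * (v * η ^ 2)) = 1 / 4 * v * (s.card * η ^ 2) := by ring
          rw [this, hηR]
          nlinarith
        linarith
      have hsub : (G1 ∪ G2)ᶜ ⊆ Prod.mk D ⁻¹' S := by
        intro D' hD'
        simp only [G1, G2, Set.mem_compl_iff, Set.mem_union, Set.mem_ofPred_eq, not_or, not_lt]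
          at hD'
        obtain ⟨k, hk, hk'⟩ := exists_scale_of_deviation hη0 ha0 hav hi hD'.1
          hD'.2
        obtain ⟨j, hj⟩ := hhalfk k i
        have h24 : ((2 : ℝ) ^ k) ^ 2 = 4 ^ k := by rw [← pow_mul, mul_comm, pow_mul]; norm_num
        have hnorm : ∑ t ∈ s, (f j (D t) ^ 2 + f j (D' t) ^ 2) ≤ 2 * 4 ^ 12 * R := by
          have : ∑ t ∈ s, (f j (D t) ^ 2 + f j (D' t) ^ 2) = s.card *
              ((empMean s D (fun o => f i o ^ 2) + empMean s D' (fun o => f i o ^ 2)) / 4 ^ k) := by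
            simp only [empMean, hj, div_pow, h24]
            rw [Finset.sum_add_distrib, ← Finset.sum_div, ← Finset.sum_div]
            field_simp
          rw [this]
          nlinarith [mul_le_mul_of_nonneg_left hk hN.le]
        have hthr : 2 ^ 20 * R = s.card * (η ^ 2 / 16) := by linarith
        rcases hk' with hk' | hk'
        · refine Or.inl ⟨hD, j, hnorm, ?_⟩
          have : ∑ t ∈ s, (id (f j (D t)) - id (f j (D' t))) = s.card *
              ((empMean s D (f i) - empMean s D' (f i)) / 2 ^ k) := by
            simp only [empMean, hj, id]
            rw [Finset.sum_sub_distrib, ← Finset.sum_div, ← Finset.sum_div]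
            field_simp
          simp only [this, hthr]
          rw [abs_mul, abs_of_pos hN, abs_div, abs_of_pos (by positivity : (0 : ℝ) < 2 ^ k)]
          gcongr
        · refine Or.inr ⟨hD, j, hnorm, ?_⟩
          have : ∑ t ∈ s, ((f j (D t)) ^ 2 - (f j (D' t)) ^ 2) = s.card *
              ((empMean s D (fun o => f i o ^ 2) - empMean s D' (fun o => f i o ^ 2)) / 4 ^ k) := by
            simp only [empMean, hj, div_pow, h24]
            rw [Finset.sum_sub_distrib, ← Finset.sum_div, ← Finset.sum_div]
            field_simp
          simp only [this, hthr]
          rw [abs_mul, abs_of_pos hN, abs_div, abs_of_pos (by positivity : (0 : ℝ) < 4 ^ k)]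
          gcongr
      have hU : (Measure.pi ν) (G1 ∪ G2) ≤ 1 / 2 := by
        refine (measure_union_le _ _).trans ((add_le_add hG1 hG2).trans (le_of_eq ?_))
        rw [ENNReal.div_add_div_same, one_add_one_eq_two, ENNReal.div_eq_div_iff] <;> norm_num
      refine le_trans ?_ (measure_mono hsub)
      have hone : (1 : ENNReal) ≤ (Measure.pi ν) (G1 ∪ G2) + (Measure.pi ν) (G1 ∪ G2)ᶜ := by
        rw [← measure_univ (μ := Measure.pi ν), ← Set.union_compl_self (G1 ∪ G2)]
        exact measure_union_le _ _
      have hone' : (1 / 2 : ENNReal) + 1 / 2 ≤ 1 / 2 + (Measure.pi ν) (G1 ∪ G2)ᶜ := by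
        rw [ENNReal.add_halves]
        exact hone.trans (add_le_add_left hU _)
      exact (ENNReal.add_le_add_iff_left (by simp)).1 hone')
  refine hghost.trans ?_
  have hid := prod_swapEvent_le hf hf1 h0 hhalf s hR0 ν measurable_id rfl
    (fun a b _ _ => by simp only [id]; linarith [abs_nonneg (a - b)])
  have hsq := prod_swapEvent_le hf hf1 h0 hhalf s hR0 ν (φ := fun a => a ^ 2)
    (measurable_id.pow_const 2) (by simp)
    (fun a b ha hb => by
      rw [sq_sub_sq, abs_mul]
      gcongr
      exact (abs_add_le a b).trans (by linarith))
  calc 2 * ((Measure.pi ν).prod (Measure.pi ν)) S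
      ≤ 2 * (ENNReal.ofReal (2 * Real.exp (-R)) + ENNReal.ofReal (2 * Real.exp (-R))) := by
        gcongr
        exact (measure_union_le _ _).trans (add_le_add hid hsq)
    _ = ENNReal.ofReal (8 * Real.exp (-R)) := by
        rw [← ENNReal.ofReal_add (by positivity) (by positivity),
          show (2 : ENNReal) = ENNReal.ofReal 2 by simp, ← ENNReal.ofReal_mul (by norm_num)]
        ring_nf

end FixedRadius
end IES

namespace IES

open scoped BigOperators
open ProbabilityTheory

/-! ### All dyadic radii at once; data-dependent critical radii -/

section AllRadii

variable {ι κ Ω : Type*} [Fintype ι] [DecidableEq ι] [MeasurableSpace Ω]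

/-- The tail bound of `pi_not_concentrates_le`, simultaneously for all radii `2 ^ j * r₀`. -/
lemma pi_exists_radius_not_concentrates_le [Countable κ] [Nonempty κ] {f : κ → Ω → ℝ}
    (hf : ∀ i, Measurable (f i))
    (hf1 : ∀ i o, |f i o| ≤ 1) (h0 : ∃ i, ∀ o, f i o = 0)
    (hhalf : ∀ i, ∃ j, ∀ o, f j o = f i o / 2) {s : Finset ι} (hs : s.Nonempty) {ξ : ℝ}
    (hξ : ξ ∈ Set.Ioo (0 : ℝ) 1) (ν : ι → Measure Ω) [∀ t, IsProbabilityMeasure (ν t)]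
    (μ : Measure Ω) [IsProbabilityMeasure μ] (hν : ∀ t ∈ s, ν t = μ) {r₀ : ℝ} (hr₀ : 0 < r₀)
    (hr₀ξ : s.card * r₀ ^ 2 = Real.log (16 / ξ)) :
    (Measure.pi ν) {D | ∃ j : ℕ, rad s (s.card * (2 ^ j * r₀) ^ 2) (fun i t => f i (D t))
        ≤ s.card * (2 ^ j * r₀) ^ 2 ∧
      ∃ i, ¬ Concentrates s D μ (4096 * (2 ^ j * r₀)) (f i)} ≤ ENNReal.ofReal ξ := by
  obtain ⟨hξ0, hξ1⟩ := hξ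
  set L := Real.log (16 / ξ) with hL
  have hL1 : 1 ≤ L := by
    rw [hL, Real.le_log_iff_exp_le (by positivity)]
    have := Real.exp_one_lt_d9
    have h16 : 16 ≤ 16 / ξ := by rw [le_div_iff₀ hξ0]; linarith
    linarith
  have hq : Real.exp (-L) = ξ / 16 := by
    rw [Real.exp_neg, hL, Real.exp_log (by positivity), inv_div]
  set q := ξ / 16 with hq'
  have hq0 : 0 < q := by positivity
  have hq1 : q ≤ 1 / 2 := by rw [hq']; linarith
  have hRj : ∀ j : ℕ, s.card * (2 ^ j * r₀) ^ 2 = 4 ^ j * L := by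
    intro j
    have h24 : ((2 : ℝ) ^ j) ^ 2 = 4 ^ j := by rw [← pow_mul, mul_comm, pow_mul]; norm_num
    rw [← hr₀ξ, mul_pow, h24]; ring
  -- The exponents grow like `4 ^ j ≥ j + 1`, so a geometric series dominates. Its sum `8q / (1 -
  -- q)` is at most `16q = ξ`, which is where the constant 16 comes from.
  have hbound : ∀ j : ℕ, 8 * Real.exp (-(s.card * (2 ^ j * r₀) ^ 2)) ≤ 8 * q * q ^ j := by
    intro j
    rw [hRj, mul_assoc, ← pow_succ', ← hq, ← Real.exp_nat_mul]
    have hj : ((j + 1 : ℕ) : ℝ) ≤ 4 ^ j := by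
      exact_mod_cast Nat.succ_le_of_lt (Nat.lt_pow_self (by norm_num))
    have : ((j + 1 : ℕ) : ℝ) * L ≤ 4 ^ j * L := by gcongr
    gcongr
    linarith
  have hsum : HasSum (fun j : ℕ => 8 * q * q ^ j) (8 * q * (1 - q)⁻¹) :=
    (hasSum_geometric_of_lt_one hq0.le (by linarith)).mul_left _
  have hset : {D : ι → Ω | ∃ j : ℕ, rad s (s.card * (2 ^ j * r₀) ^ 2) (fun i t => f i (D t))
        ≤ s.card * (2 ^ j * r₀) ^ 2 ∧
      ∃ i, ¬ Concentrates s D μ (4096 * (2 ^ j * r₀)) (f i)} =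
      ⋃ j : ℕ, {D | rad s (s.card * (2 ^ j * r₀) ^ 2) (fun i t => f i (D t))
        ≤ s.card * (2 ^ j * r₀) ^ 2 ∧
      ∃ i, ¬ Concentrates s D μ (4096 * (2 ^ j * r₀)) (f i)} := by ext D; simp
  rw [hset]
  calc _ ≤ ∑' j : ℕ, ENNReal.ofReal (8 * q * q ^ j) := by
        refine (measure_iUnion_le _).trans (ENNReal.tsum_le_tsum fun j => ?_)
        refine (pi_not_concentrates_le hf hf1 h0 hhalf hs (by positivity) ?_ ν μ hν).trans
          (ENNReal.ofReal_le_ofReal (hbound j))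
        rw [hRj]
        have : (1 : ℝ) ≤ 4 ^ j := one_le_pow₀ (by norm_num)
        nlinarith
    _ = ENNReal.ofReal (8 * q * (1 - q)⁻¹) := by
        rw [← ENNReal.ofReal_tsum_of_nonneg (fun j => by positivity) hsum.summable, hsum.tsum_eq]
    _ ≤ ENNReal.ofReal ξ := by
        refine ENNReal.ofReal_le_ofReal ?_
        rw [← div_eq_mul_inv, div_le_iff₀ (by linarith)]
        rw [show ξ = 16 * q by rw [hq']; ring]
        nlinarith

omit [MeasurableSpace Ω] in
/-- A critical radius of a star-shaped class bounds the localized complexity of a scaled subclass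
at all larger radii. -/
lemma rad_le_of_isCriticalRadius [Nonempty κ] {s : Finset ι} (hs : s.Nonempty) {D : ι → Ω}
    {F : Set (Ω → ℝ)} {b δ r : ℝ} (hF0 : 0 ∈ F) (hF : StarConvex ℝ 0 F) (hb : 0 < b)
    (hδ : IsCriticalRadius s D F b δ) (hr : δ ≤ b * r) {f : κ → Ω → ℝ}
    (hf : ∀ i, ∃ g ∈ F, ∀ t ∈ s, g (D t) = b * f i (D t)) :
    rad s (s.card * r ^ 2) (fun i t => f i (D t)) ≤ s.card * r ^ 2 := by
  obtain ⟨hδ0, hδ⟩ := hδ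
  have hN : (0 : ℝ) < s.card := by exact_mod_cast hs.card_pos
  have hr0 : 0 < r := by
    by_contra h
    nlinarith [not_lt.1 h]
  unfold empRademacher at hδ
  rw [← Fintype.expect_eq_sum_div_card] at hδ
  set V : (ι → ℤˣ) → ℝ := fun ε => ⨆ f : {f : Ω → ℝ // f ∈ F ∧ empNorm s D f ≤ δ},
    (∑ t ∈ s, ((ε t : ℤ) : ℝ) * f.1 (D t)) / (s.card : ℝ) with hV
  have hnorm : ∀ {g : Ω → ℝ} {e : ℝ}, 0 ≤ e → (empNorm s D g ≤ e ↔
      ∑ t ∈ s, g (D t) ^ 2 ≤ s.card * e ^ 2) := by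
    intro g e he
    rw [empNorm, Real.sqrt_le_left he, empMean, div_le_iff₀ hN, mul_comm (e ^ 2)]
  -- The class itself need not be bounded on the data, but the localization bounds every value
  -- through `|x| ≤ 1 + x²`. Without this the real supremum could take its default value 0.
  have hbdd : ∀ ε : ι → ℤˣ, BddAbove (Set.range fun f : {f : Ω → ℝ // f ∈ F ∧
      empNorm s D f ≤ δ} => (∑ t ∈ s, ((ε t : ℤ) : ℝ) * f.1 (D t)) / (s.card : ℝ)) := by
    intro ε
    refine ⟨(∑ t ∈ s, (1 + s.card * δ ^ 2)) / s.card, ?_⟩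
    rintro _ ⟨⟨g, hg, hgδ⟩, rfl⟩
    rw [hnorm hδ0.le] at hgδ
    simp only
    gcongr with t ht
    refine (le_abs_self _).trans ?_
    rw [abs_sign_mul]
    have h1 : g (D t) ^ 2 ≤ s.card * δ ^ 2 :=
      (Finset.single_le_sum (f := fun t => g (D t) ^ 2) (fun t _ => sq_nonneg _) ht).trans hgδ
    rw [← sq_abs] at h1
    nlinarith [sq_nonneg (|g (D t)| - 1)]
  have hpt : ∀ ε : ι → ℤˣ, ⨆ i, ∑ t ∈ s, ((ε t : ℤ) : ℝ) *
      (if ∑ u ∈ s, f i (D u) ^ 2 ≤ s.card * r ^ 2 then f i (D t) else 0)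
      ≤ s.card * (r / δ) * V ε := by
    intro ε
    refine ciSup_le fun i => ?_
    by_cases h : ∑ u ∈ s, f i (D u) ^ 2 ≤ s.card * r ^ 2
    · obtain ⟨g, hg, hgf⟩ := hf i
      -- Star-shapedness: shrinking `g` by `δ / (b r)` brings a function localized at `r` into the
      -- localization at `δ`, and the signed average shrinks only linearly.
      have hc1 : δ / (b * r) ≤ 1 := (div_le_one (by positivity)).2 hr
      have hg' : (δ / (b * r)) • g ∈ F := hF.smul_mem hg (by positivity) hc1
      have hval : ∀ t ∈ s, ((δ / (b * r)) • g) (D t) = δ / r * f i (D t) := by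
        intro t ht
        rw [Pi.smul_apply, smul_eq_mul, hgf t ht]; field_simp
      have hgn : empNorm s D ((δ / (b * r)) • g) ≤ δ := by
        rw [hnorm hδ0.le, Finset.sum_congr rfl fun t ht => by rw [hval t ht]]
        simp_rw [mul_pow]
        rw [← Finset.mul_sum]
        calc (δ / r) ^ 2 * ∑ t ∈ s, f i (D t) ^ 2 ≤ (δ / r) ^ 2 * (s.card * r ^ 2) := by gcongr
          _ = _ := by field_simp
      have := le_ciSup (hbdd ε) ⟨_, hg', hgn⟩
      simp only at this
      rw [Finset.sum_congr rfl fun t ht => by rw [hval t ht]] at this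
      simp only [h, if_true]
      calc ∑ t ∈ s, ((ε t : ℤ) : ℝ) * f i (D t) = s.card * (r / δ) *
            ((∑ t ∈ s, ((ε t : ℤ) : ℝ) * (δ / r * f i (D t))) / s.card) := by
            simp_rw [mul_left_comm _ (δ / r)]
            rw [← Finset.mul_sum]
            field_simp
        _ ≤ _ := by gcongr
    · simp only [h, if_false, mul_zero, Finset.sum_const_zero]
      have h0n : empNorm s D (0 : Ω → ℝ) ≤ δ := by
        rw [hnorm hδ0.le]; simp; positivity
      have := le_ciSup (hbdd ε) ⟨0, hF0, h0n⟩
      simp only [Pi.zero_apply, mul_zero, Finset.sum_const_zero, zero_div] at this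
      exact mul_nonneg (by positivity) this
  calc _ ≤ 𝔼 ε, s.card * (r / δ) * V ε := Finset.expect_le_expect fun ε _ => hpt ε
    _ ≤ s.card * (r / δ) * (δ ^ 2 / b) := by
        rw [← Finset.mul_expect]; gcongr
    _ = s.card * r * (δ / b) := by field_simp
    _ ≤ s.card * r * r := by
        gcongr
        rw [div_le_iff₀ hb]; linarith
    _ = _ := by ring

end AllRadii

/-! ### Stability of concentration under limits and scaling -/

section Limits

variable {ι Ω : Type*} [MeasurableSpace Ω]

lemma Concentrates.of_tendsto {s : Finset ι} {D : ι → Ω} {μ : Measure Ω} [IsProbabilityMeasure μ]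
    {η : ℝ} {a : ℕ → Ω → ℝ} {g : Ω → ℝ} (hm : ∀ n, Measurable (a n)) (h1 : ∀ n o, |a n o| ≤ 1)
    (hlim : ∀ o, Tendsto (fun n => a n o) atTop (𝓝 (g o)))
    (h : ∀ n, Concentrates s D μ η (a n)) : Concentrates s D μ η g := by
  have i1 : Tendsto (fun n => ∫ o, a n o ∂μ) atTop (𝓝 (∫ o, g o ∂μ)) :=
    tendsto_integral_of_dominated_convergence (fun _ => 1)
      (fun n => (hm n).aestronglyMeasurable) (integrable_const _)
      (fun n => ae_of_all _ fun o => h1 n o) (ae_of_all _ hlim)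
  have i2 : Tendsto (fun n => ∫ o, a n o ^ 2 ∂μ) atTop (𝓝 (∫ o, g o ^ 2 ∂μ)) :=
    tendsto_integral_of_dominated_convergence (fun _ => 1)
      (fun n => ((hm n).pow_const 2).aestronglyMeasurable) (integrable_const _)
      (fun n => ae_of_all _ fun o => by
        rw [norm_pow]; exact pow_le_one₀ (norm_nonneg _) (h1 n o))
      (ae_of_all _ fun o => (hlim o).pow 2)
  have e1 : Tendsto (fun n => empMean s D (a n)) atTop (𝓝 (empMean s D g)) :=
    (tendsto_finsetSum _ fun t _ => hlim (D t)).div_const _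
  have e2 : Tendsto (fun n => empMean s D (fun o => a n o ^ 2)) atTop
      (𝓝 (empMean s D fun o => g o ^ 2)) :=
    (tendsto_finsetSum _ fun t _ => (hlim (D t)).pow 2).div_const _
  have l2 : Tendsto (fun n => l2norm μ (a n)) atTop (𝓝 (l2norm μ g)) :=
    (Real.continuous_sqrt.tendsto _).comp i2
  exact ⟨le_of_tendsto_of_tendsto' (e2.sub i2).abs ((i2.add_const _).const_mul _) fun n => (h n).1,
    le_of_tendsto_of_tendsto' (e1.sub i1).abs ((l2.add_const _).const_mul _) fun n => (h n).2⟩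

/-- The second-moment inequality is homogeneous when `η` scales with `b`. The inequality for means
has degree one on the left and two on the right, so it has a factor `b ≥ 1` to spare. Agreement on
the sample and almost everywhere suffices, which allows truncated functions. -/
lemma Concentrates.of_scaled {s : Finset ι} {D : ι → Ω} {μ : Measure Ω}
    {η η' b : ℝ} {f g : Ω → ℝ} (hb : 1 ≤ b) (hη' : 0 ≤ η') (hη : b * η' ≤ η)
    (hD : ∀ t ∈ s, g (D t) = b * f (D t)) (hae : ∀ᵐ o ∂μ, g o = b * f o)
    (h : Concentrates s D μ η' f) : Concentrates s D μ η g := by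
  have hb0 : 0 < b := by linarith
  have i1 : ∫ o, g o ∂μ = b * ∫ o, f o ∂μ := by
    rw [integral_congr_ae hae, integral_const_mul]
  have i2 : ∫ o, g o ^ 2 ∂μ = b ^ 2 * ∫ o, f o ^ 2 ∂μ := by
    rw [← integral_const_mul]
    refine integral_congr_ae ?_
    filter_upwards [hae] with o ho
    rw [ho, mul_pow]
  have e1 : empMean s D g = b * empMean s D f := by
    rw [empMean, Finset.sum_congr rfl hD, ← Finset.mul_sum, empMean, mul_div_assoc]
  have e2 : empMean s D (fun o => g o ^ 2) = b ^ 2 * empMean s D (fun o => f o ^ 2) := by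
    rw [empMean, Finset.sum_congr rfl fun t ht => by rw [hD t ht, mul_pow], ← Finset.mul_sum,
      empMean, mul_div_assoc]
  have l : l2norm μ g = b * l2norm μ f := by
    rw [l2norm, i2, Real.sqrt_mul (sq_nonneg _), Real.sqrt_sq hb0.le, l2norm]
  have hl0 : 0 ≤ l2norm μ f := Real.sqrt_nonneg _
  have hη'' : η' ≤ η := by nlinarith
  refine ⟨?_, ?_⟩
  · rw [i2, e2, ← mul_sub, abs_mul, abs_of_pos (by positivity)]
    calc b ^ 2 * _ ≤ b ^ 2 * _ := mul_le_mul_of_nonneg_left h.1 (by positivity)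
      _ ≤ _ := by nlinarith [mul_le_mul hη hη (by positivity) (by linarith)]
  · rw [i1, e1, l, ← mul_sub, abs_mul, abs_of_pos hb0]
    calc b * _ ≤ b * _ := mul_le_mul_of_nonneg_left h.2 hb0.le
      _ = η' * (b * l2norm μ f + b * η') := by ring
      _ ≤ _ := by
        have := hη'.trans hη''
        gcongr

end Limits

/-! ### Uniform concentration of separable star-shaped classes -/

section SeparableClass

variable {ι Ω : Type*} [Fintype ι] [DecidableEq ι] [MeasurableSpace Ω]

/-- The least dyadic multiple of `r₀` above `d` overshoots by at most a factor two, unless it is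
`r₀` itself. -/
lemma exists_dyadic_between {d r₀ : ℝ} (hr₀ : 0 < r₀) :
    ∃ j : ℕ, d ≤ 2 ^ j * r₀ ∧ 2 ^ j * r₀ ≤ max r₀ (2 * d) := by
  classical
  have hex : ∃ j : ℕ, d ≤ 2 ^ j * r₀ := by
    obtain ⟨j, hj⟩ := pow_unbounded_of_one_lt (d / r₀) (by norm_num : (1 : ℝ) < 2)
    rw [div_lt_iff₀ hr₀] at hj
    exact ⟨j, hj.le⟩
  refine ⟨Nat.find hex, Nat.find_spec hex, ?_⟩
  rcases h : Nat.find hex with _ | k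
  · simp
  · have := Nat.find_min hex (m := k) (by omega)
    push Not at this
    refine le_max_of_le_right ?_
    rw [pow_succ]
    linarith

/-- Uniform concentration of a separable star-shaped class at any scale that bounds an empirical
critical radius, with high probability. -/
theorem exists_exceptional_set {s : Finset ι} (hs : s.Nonempty) {ξ : ℝ}
    (hξ : ξ ∈ Set.Ioo (0 : ℝ) 1) (ν : ι → Measure Ω) [∀ t, IsProbabilityMeasure (ν t)]
    (μ : Measure Ω) [IsProbabilityMeasure μ] (hν : ∀ t ∈ s, ν t = μ) {b : ℝ} (hb : 1 ≤ b)
    {F : Set (Ω → ℝ)} (hF0 : 0 ∈ F) (hF : StarConvex ℝ 0 F) (hsep : PointwiseSeparable F)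
    (hm : ∀ g ∈ F, Measurable g) {G : Set Ω} (hG : MeasurableSet G) (hGμ : ∀ᵐ o ∂μ, o ∈ G)
    (hFb : ∀ g ∈ F, ∀ o ∈ G, |g o| ≤ b) :
    ∃ B : Set (ι → Ω), (Measure.pi ν) B ≤ ENNReal.ofReal ξ ∧
      ∀ D ∉ B, (∀ t ∈ s, D t ∈ G) → ∀ δ η : ℝ, IsCriticalRadius s D F b δ →
        8192 * (δ + b * Real.sqrt (Real.log (16 / ξ) / s.card)) ≤ η →
        ∀ g ∈ F, Concentrates s D μ η g := by
  obtain ⟨C, hCF, hC, hdense⟩ := hsep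
  have hb0 : 0 < b := by linarith
  have hN : (0 : ℝ) < s.card := by exact_mod_cast hs.card_pos
  have : Countable C := hC.to_subtype
  have hCne : Nonempty C := by
    obtain ⟨a, ha, -⟩ := hdense 0 hF0
    exact ⟨⟨a 0, ha 0⟩⟩
  -- The weights `0, 1, 1/2, 1/4, …` make the countable class contain zero and be closed under
  -- halving; index 1 gives back the unscaled function.
  let w : ℕ → ℝ := fun n => if n = 0 then 0 else (1 / 2) ^ (n - 1)
  have hw0 : ∀ n, 0 ≤ w n := by intro n; simp only [w]; split_ifs <;> positivity
  have hw1 : ∀ n, w n ≤ 1 := by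
    intro n; simp only [w]; split_ifs
    · exact zero_le_one
    · exact pow_le_one₀ (by norm_num) (by norm_num)
  -- Functions of the class are bounded only on the full-measure set `G`; truncation makes the bound
  -- hold everywhere without changing values on samples in `G`.
  let f : C × ℕ → Ω → ℝ := fun i o => w i.2 * (G.indicator i.1.1 o / b)
  have hfm : ∀ i, Measurable (f i) := fun i =>
    (((hm _ (hCF i.1.2)).indicator hG).div_const b).const_mul _
  have hind : ∀ g ∈ F, ∀ o, |G.indicator g o / b| ≤ 1 := by
    intro g hg o
    rw [abs_div, abs_of_pos hb0, div_le_one hb0]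
    by_cases ho : o ∈ G
    · rw [Set.indicator_of_mem ho]; exact hFb g hg o ho
    · rw [Set.indicator_of_notMem ho]; simpa using hb0.le
  have hf1 : ∀ i o, |f i o| ≤ 1 := by
    intro i o
    simp only [f]
    rw [abs_mul, abs_of_nonneg (hw0 _)]
    exact mul_le_one₀ (hw1 _) (abs_nonneg _) (hind _ (hCF i.1.2) o)
  have hf0 : ∃ i, ∀ o, f i o = 0 := ⟨(hCne.some, 0), fun o => by simp [f, w]⟩
  have hfhalf : ∀ i, ∃ j, ∀ o, f j o = f i o / 2 := by
    rintro ⟨c, n⟩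
    rcases n with _ | n
    · exact ⟨(c, 0), fun o => by simp [f, w]⟩
    · exact ⟨(c, n + 2), fun o => by simp [f, w, pow_succ]; ring⟩
  set r₀ := Real.sqrt (Real.log (16 / ξ) / s.card) with hr₀
  have hlog : 0 < Real.log (16 / ξ) :=
    Real.log_pos (by rw [lt_div_iff₀ hξ.1]; linarith [hξ.2])
  have hr₀0 : 0 < r₀ := Real.sqrt_pos.2 (by positivity)
  have hr₀ξ : s.card * r₀ ^ 2 = Real.log (16 / ξ) := by
    rw [hr₀, Real.sq_sqrt (by positivity)]; field_simp
  refine ⟨_, pi_exists_radius_not_concentrates_le hfm hf1 hf0 hfhalf hs hξ ν μ hν hr₀0 hr₀ξ, ?_⟩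
  intro D hD hDG δ η hδ hη g hg
  obtain ⟨j, hj1, hj2⟩ := exists_dyadic_between (d := δ / b) hr₀0
  have hconc : ∀ i, Concentrates s D μ (4096 * (2 ^ j * r₀)) (f i) := by
    intro i
    by_contra hcon
    refine hD ⟨j, ?_, i, hcon⟩
    refine rad_le_of_isCriticalRadius hs hF0 hF hb0 hδ ?_ ?_
    · rw [div_le_iff₀ hb0] at hj1; linarith
    · intro i
      refine ⟨w i.2 • i.1.1, hF.smul_mem (hCF i.1.2) (hw0 _) (hw1 _), fun t ht => ?_⟩
      simp only [f, Pi.smul_apply, smul_eq_mul, Set.indicator_of_mem (hDG t ht)]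
      field_simp
  obtain ⟨a, ha, hlim⟩ := hdense g hg
  have hlim' : Concentrates s D μ (4096 * (2 ^ j * r₀)) (fun o => G.indicator g o / b) := by
    refine Concentrates.of_tendsto (a := fun n o => G.indicator (a n) o / b)
      (fun n => ((hm _ (hCF (ha n))).indicator hG).div_const b) (fun n => hind _ (hCF (ha n))) ?_ ?_
    · intro o
      refine Tendsto.div_const ?_ b
      by_cases ho : o ∈ G
      · simpa only [Set.indicator_of_mem ho] using hlim o
      · simp only [Set.indicator_of_notMem ho]; exact tendsto_const_nhds
    · intro n
      have := hconc (⟨a n, ha n⟩, 1)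
      simpa [f, w] using this
  refine hlim'.of_scaled hb (by positivity) ?_ (fun t ht => ?_) ?_
  -- The dyadic overshoot doubles the scale 4096, whence the constant 8192 in front of `δ`.
  · have hmax : max r₀ (2 * (δ / b)) ≤ r₀ + 2 * (δ / b) :=
      max_le (le_add_of_nonneg_right (by have := hδ.1; positivity)) (le_add_of_nonneg_left hr₀0.le)
    have : b * (4096 * (2 ^ j * r₀)) ≤ b * (4096 * (r₀ + 2 * (δ / b))) := by
      gcongr; exact hj2.trans hmax
    have h2 : b * (4096 * (r₀ + 2 * (δ / b))) = 4096 * (b * r₀) + 8192 * δ := by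
      field_simp
      ring
    have h3 : 0 ≤ b * r₀ := by positivity
    linarith
  · rw [Set.indicator_of_mem (hDG t ht)]; field_simp
  · filter_upwards [hGμ] with o ho
    rw [Set.indicator_of_mem ho]; field_simp

end SeparableClass
end IES

namespace IES

open ProbabilityTheory

/-! ### Conditioning on the pattern of complete trials -/

section Subsample

variable {ι Ω : Type*} [Fintype ι] [DecidableEq ι] [MeasurableSpace Ω]

/-- The set `O` for indices in `s` and its complement for the others. -/
def patternSet (O : Set Ω) (s : Finset ι) (t : ι) : Set Ω := if t ∈ s then O else Oᶜ

omit [Fintype ι] in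
lemma measurableSet_patternSet {O : Set Ω} (hO : MeasurableSet O) (s : Finset ι) (t : ι) :
    MeasurableSet (patternSet O s t) := by
  unfold patternSet; split_ifs
  exacts [hO, hO.compl]

/-- Independent trials with a given pattern of membership in `O` are independent trials under the
conditional laws. -/
lemma pi_restrict_patternSet (P : Measure Ω) [IsProbabilityMeasure P] {O : Set Ω}
    (hO : MeasurableSet O) (s : Finset ι) (h : ∀ t, P (patternSet O s t) ≠ 0) :
    (Measure.pi fun _ : ι => P).restrict (Set.univ.pi (patternSet O s)) =
      (∏ t, P (patternSet O s t)) • Measure.pi fun t => cond P (patternSet O s t) := by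
  rw [Measure.restrict_pi_pi]
  refine Measure.pi_eq fun A hA => ?_
  rw [Measure.smul_apply, Measure.pi_pi, smul_eq_mul, ← Finset.prod_mul_distrib]
  refine Finset.prod_congr rfl fun t _ => ?_
  rw [cond_apply (measurableSet_patternSet hO s t), ← mul_assoc,
    ENNReal.mul_inv_cancel (h t) (measure_ne_top _ _), one_mul, Measure.restrict_apply (hA t),
    Set.inter_comm]

/-- A bound for the probability of an event follows from bounds conditional on the pattern of
membership in `O`. -/
lemma pi_le_of_forall_pattern (P : Measure Ω) [IsProbabilityMeasure P] {O : Set Ω}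
    (hO : MeasurableSet O) (E : Set (ι → Ω)) (c : ENNReal)
    (h : ∀ s : Finset ι, (∀ t, P (patternSet O s t) ≠ 0) →
      (Measure.pi fun t => cond P (patternSet O s t)) (E ∩ Set.univ.pi (patternSet O s)) ≤ c) :
    (Measure.pi fun _ : ι => P) E ≤ c := by
  classical
  set Q := Measure.pi fun _ : ι => P with hQ
  have hm : ∀ s : Finset ι, MeasurableSet (Set.univ.pi (patternSet O s)) := fun s =>
    MeasurableSet.univ_pi fun t => measurableSet_patternSet hO s t
  have hpart : ∀ s : Finset ι, Q (E ∩ Set.univ.pi (patternSet O s)) ≤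
      c * Q (Set.univ.pi (patternSet O s)) := by
    intro s
    by_cases hs : ∀ t, P (patternSet O s t) ≠ 0
    · have h1 : Q (E ∩ Set.univ.pi (patternSet O s)) =
          Q.restrict (Set.univ.pi (patternSet O s)) (E ∩ Set.univ.pi (patternSet O s)) := by
        rw [Measure.restrict_apply' (hm s), Set.inter_assoc, Set.inter_self]
      rw [h1, hQ, pi_restrict_patternSet P hO s hs, Measure.pi_pi, Measure.smul_apply, smul_eq_mul,
        mul_comm]
      gcongr
      exact h s hs
    · push Not at hs
      obtain ⟨t, ht⟩ := hs
      have : Q (Set.univ.pi (patternSet O s)) = 0 := by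
        rw [hQ, Measure.pi_pi]; exact Finset.prod_eq_zero (Finset.mem_univ t) ht
      rw [measure_mono_null Set.inter_subset_right this]
      exact zero_le
  have hcover : E ⊆ ⋃ s : Finset ι, E ∩ Set.univ.pi (patternSet O s) := by
    intro D hD
    refine Set.mem_iUnion.2 ⟨Finset.univ.filter fun t => D t ∈ O, hD, fun t _ => ?_⟩
    by_cases ht : D t ∈ O <;> simp [patternSet, ht]
  have hdisj : Pairwise (Function.onFun Disjoint fun s : Finset ι =>
      Set.univ.pi (patternSet O s)) := by
    intro s s' hss'
    refine Set.disjoint_left.2 fun D hD hD' => hss' ?_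
    ext t
    have h1 := hD t (Set.mem_univ t)
    have h2 := hD' t (Set.mem_univ t)
    by_cases ht : t ∈ s <;> by_cases ht' : t ∈ s' <;> simp_all [patternSet]
  calc Q E ≤ ∑ s : Finset ι, Q (E ∩ Set.univ.pi (patternSet O s)) :=
        (measure_mono hcover).trans (measure_iUnion_fintype_le _ _)
    _ ≤ ∑ s : Finset ι, c * Q (Set.univ.pi (patternSet O s)) :=
        Finset.sum_le_sum fun s _ => hpart s
    _ = c * Q (⋃ s : Finset ι, Set.univ.pi (patternSet O s)) := by
        rw [← Finset.mul_sum, measure_iUnion hdisj hm, tsum_fintype]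
    _ ≤ c * 1 := by gcongr; exact prob_le_one
    _ = c := mul_one c

/-- The conditional product law is, up to a nonzero factor, a restriction of the original one, so
null sets pass over. This transfers the almost sure bound on the critical radii. -/
lemma ae_pi_cond_of_ae_pi (P : Measure Ω) [IsProbabilityMeasure P] {O : Set Ω}
    (hO : MeasurableSet O) (s : Finset ι) (h : ∀ t, P (patternSet O s t) ≠ 0)
    {p : (ι → Ω) → Prop} (hp : ∀ᵐ D ∂(Measure.pi fun _ : ι => P), p D) :
    ∀ᵐ D ∂(Measure.pi fun t => cond P (patternSet O s t)), p D := by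
  have h1 := ae_restrict_of_ae (s := Set.univ.pi (patternSet O s)) hp
  rw [pi_restrict_patternSet P hO s h] at h1
  have h2 : ∏ t, P (patternSet O s t) ≠ 0 :=
    Finset.prod_induction _ (· ≠ 0) (fun _ _ => mul_ne_zero) one_ne_zero fun t _ => h t
  exact Measure.absolutelyContinuous_smul h2 h1

end Subsample

/-! ### Probability of the deviation event -/

namespace MomentSystem

universe u v w

variable {m : ℕ} {M : MomentSystem.{u, v, w} m} {H : ∀ j, Set (M.Arg j → ℝ)}
  {Θ : ∀ k, Set (M.Inst k → ℝ)} {Lα₁ LY Lh Lθ Lα : ℝ}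

instance isProbabilityMeasure_μ (k : Fin (m + 1)) : IsProbabilityMeasure (M.μ k) :=
  cond_isProbabilityMeasure (M.law_observed k)

/-- The Lipschitz condition enters only through this continuity: it makes residuals measurable and
carries pointwise separability over to products of residuals and test functions. -/
lemma Regular.tendsto_α (hreg : M.Regular H Θ Lα₁ LY Lh Lθ Lα) (k : Fin (m + 1))
    {u : (Fin (m + 1) → ℝ)} {y : Fin (M.dimY k) → ℝ} {β : Type*} {l : Filter β}
    {f : β → (Fin (m + 1) → ℝ)} {g : β → (Fin (M.dimY k) → ℝ)} (hf : Tendsto f l (𝓝 u))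
    (hg : Tendsto g l (𝓝 y)) : Tendsto (fun n => M.α k (f n) (g n)) l (𝓝 (M.α k u y)) := by
  rw [tendsto_iff_dist_tendsto_zero]
  have hz : Tendsto (fun n => Lα₁ * (∑ j, |f n j - u j| + ‖g n - y‖)) l (𝓝 0) := by
    have h1 : ∀ j, Tendsto (fun n => |f n j - u j|) l (𝓝 0) := fun j => by
      simpa using ((tendsto_pi_nhds.1 hf j).sub_const (u j)).abs
    have h2 : Tendsto (fun n => ‖g n - y‖) l (𝓝 0) := by simpa using (hg.sub_const y).norm
    simpa using ((tendsto_finsetSum Finset.univ fun j _ => h1 j).add h2).const_mul Lα₁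
  exact squeeze_zero (fun _ => dist_nonneg) (fun n => by
    rw [Real.dist_eq]; exact hreg.lipschitz k _ _ _ _) hz

lemma Regular.measurable_res (hreg : M.Regular H Θ Lα₁ LY Lh Lθ Lα) {h : M.Fns}
    (hh : h ∈ M.hyp H) (k : Fin (m + 1)) : Measurable (M.res k h) := by
  have hc : Continuous fun p : (Fin (m + 1) → ℝ) × (Fin (M.dimY k) → ℝ) => M.α k p.1 p.2 :=
    continuous_iff_continuousAt.2 fun p =>
      hreg.tendsto_α k (continuous_fst.tendsto p) (continuous_snd.tendsto p)
  exact hc.measurable.comp ((measurable_pi_lambda _ fun j =>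
    (hreg.measurable_H j _ (hh j)).comp (M.measurable_X k j)).prodMk (M.measurable_Y k))

lemma Regular.measurable_test (hreg : M.Regular H Θ Lα₁ LY Lh Lθ Lα) {k : Fin (m + 1)}
    {θ : M.Inst k → ℝ} (hθ : θ ∈ Θ k) : Measurable (M.test k θ) :=
  (hreg.measurable_Θ k θ hθ).comp (M.measurable_Z k)

lemma Regular.abs_res_le (hreg : M.Regular H Θ Lα₁ LY Lh Lθ Lα) {h : M.Fns}
    (hh : h ∈ M.hyp H) {k : Fin (m + 1)} {o : M.Trial} (ho : ‖M.Y k o‖ ≤ LY) :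
    |M.res k h o| ≤ Lα :=
  hreg.bounded_α k h hh (fun j => M.X k j o) (M.Y k o) ho

lemma Regular.nonneg_Lα (hreg : M.Regular H Θ Lα₁ LY Lh Lθ Lα) {h : M.Fns}
    (hh : h ∈ M.hyp H) : 0 ≤ Lα := by
  obtain ⟨o, ho⟩ := (hreg.bounded_Y 0).exists
  exact (abs_nonneg _).trans (hreg.abs_res_le hh ho)

lemma starConvex_testClass (hΘ : ∀ k, (0 : M.Inst k → ℝ) ∈ Θ k ∧ StarConvex ℝ 0 (Θ k))
    (k : Fin (m + 1)) : 0 ∈ M.testClass Θ k ∧ StarConvex ℝ 0 (M.testClass Θ k) := by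
  refine ⟨⟨0, (hΘ k).1, rfl⟩, ?_⟩
  rw [starConvex_zero_iff]
  rintro _ ⟨θ, hθ, rfl⟩ c h0 h1
  exact ⟨c • θ, (hΘ k).2.smul_mem hθ h0 h1, rfl⟩

lemma starConvex_Q (hΘ : ∀ k, (0 : M.Inst k → ℝ) ∈ Θ k ∧ StarConvex ℝ 0 (Θ k)) {h : M.Fns}
    (hh : h ∈ M.hyp H) (k : Fin (m + 1)) : 0 ∈ M.Q H Θ k ∧ StarConvex ℝ 0 (M.Q H Θ k) := by
  refine ⟨⟨h, hh, 0, (hΘ k).1, ?_⟩, ?_⟩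
  · funext o; simp [test]
  · rw [starConvex_zero_iff]
    rintro _ ⟨h, hh, θ, hθ, rfl⟩ c h0 h1
    refine ⟨h, hh, c • θ, (hΘ k).2.smul_mem hθ h0 h1, ?_⟩
    funext o
    simp [test, mul_left_comm]

lemma pointwiseSeparable_testClass (hsep : ∀ k, PointwiseSeparable (Θ k)) (k : Fin (m + 1)) :
    PointwiseSeparable (M.testClass Θ k) := by
  obtain ⟨C, hCΘ, hC, hd⟩ := hsep k
  refine ⟨M.test k '' C, ?_, hC.image _, ?_⟩
  · rintro _ ⟨θ, hθ, rfl⟩; exact ⟨θ, hCΘ hθ, rfl⟩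
  · rintro _ ⟨θ, hθ, rfl⟩
    obtain ⟨a, ha, hlim⟩ := hd θ hθ
    exact ⟨fun n => M.test k (a n), fun n => ⟨a n, ha n, rfl⟩, fun o => hlim _⟩

lemma Regular.pointwiseSeparable_Q (hreg : M.Regular H Θ Lα₁ LY Lh Lθ Lα)
    (hsepH : ∀ j, PointwiseSeparable (H j)) (hsepΘ : ∀ k, PointwiseSeparable (Θ k))
    (k : Fin (m + 1)) : PointwiseSeparable (M.Q H Θ k) := by
  choose C hCH hC hd using hsepH
  obtain ⟨C', hCΘ, hC', hd'⟩ := hsepΘ k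
  refine ⟨Set.image2 (fun (h : M.Fns) θ o => M.res k h o * M.test k θ o) (Set.univ.pi C) C',
    ?_, (Set.countable_univ_pi hC).image2 hC' _, ?_⟩
  · rintro _ ⟨h, hh, θ, hθ, rfl⟩
    exact ⟨h, fun j => hCH j (hh j trivial), θ, hCΘ hθ, rfl⟩
  · rintro _ ⟨h, hh, θ, hθ, rfl⟩
    choose a ha hlim using fun j => hd j (h j) (hh j)
    obtain ⟨a', ha', hlim'⟩ := hd' θ hθ
    refine ⟨fun n o => M.res k (fun j => a j n) o * M.test k (a' n) o,
      fun n => ⟨fun j => a j n, fun j _ => ha j n, a' n, ha' n, rfl⟩, fun o => ?_⟩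
    exact (hreg.tendsto_α k (tendsto_pi_nhds.2 fun j => hlim j _) tendsto_const_nhds).mul (hlim' _)

/-- The uniform deviation inequalities in the `k`-th equation. -/
lemma pi_not_deviation_le (hreg : M.Regular H Θ Lα₁ LY Lh Lθ Lα) {h₀ : M.Fns}
    (hh₀ : h₀ ∈ M.hyp H)
    (hΘ : ∀ k, (0 : M.Inst k → ℝ) ∈ Θ k ∧ StarConvex ℝ 0 (Θ k))
    (hsepH : ∀ j, PointwiseSeparable (H j)) (hsepΘ : ∀ k, PointwiseSeparable (Θ k))
    {ξ b : ℝ} (hξ : ξ ∈ Set.Ioo (0 : ℝ) 1) (hb : 1 ≤ b) (hθb : Lθ ≤ b) (hαθb : Lα * Lθ ≤ b)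
    {n : ℕ} {η : Fin (m + 1) → (Fin n → M.Trial) → ℝ}
    (hη : M.BoundsCriticalRadius H Θ 8192 16 b ξ η) (k : Fin (m + 1)) :
    (Measure.pi fun _ : Fin n => M.law) {D | (M.sub k D).Nonempty ∧
      ¬ ∀ h ∈ M.hyp H, ∀ θ ∈ Θ k,
        |empMean (M.sub k D) D (fun o => M.res k h o * M.test k θ o)
            - ∫ o, M.res k h o * M.test k θ o ∂(M.μ k)|
          ≤ η k D * (Lα * l2norm (M.μ k) (M.test k θ) + η k D) ∧
        |empNorm (M.sub k D) D (M.test k θ) ^ 2 - l2norm (M.μ k) (M.test k θ) ^ 2|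
          ≤ 1 / 2 * (l2norm (M.μ k) (M.test k θ) ^ 2 + η k D ^ 2)} ≤ ENNReal.ofReal (2 * ξ) := by
  have hLα := hreg.nonneg_Lα hh₀
  have hO := M.measurableSet_observed k
  set G : Set M.Trial := {o | ‖M.Y k o‖ ≤ LY} with hG
  have hGm : MeasurableSet G := measurableSet_le (M.measurable_Y k).norm measurable_const
  refine pi_le_of_forall_pattern M.law hO _ _ fun s hs => ?_
  have hsub : ∀ D ∈ Set.univ.pi (patternSet (M.observed k) s), M.sub k D = s := by
    intro D hD
    ext t
    have := hD t trivial
    by_cases ht : t ∈ s <;> simp_all [patternSet, sub]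
  rcases s.eq_empty_or_nonempty with rfl | hsne
  · refine le_of_eq_of_le (measure_mono_null (t := ∅) ?_ measure_empty) zero_le
    rintro D ⟨⟨hD, -⟩, hD'⟩
    rw [hsub D hD'] at hD
    exact absurd hD (by simp)
  have : ∀ t, IsProbabilityMeasure (cond M.law (patternSet (M.observed k) s t)) := fun t =>
    cond_isProbabilityMeasure (hs t)
  set ν : Fin n → Measure M.Trial := fun t => cond M.law (patternSet (M.observed k) s t)
  have hν : ∀ t ∈ s, ν t = M.μ k := by
    intro t ht; simp only [ν, patternSet, if_pos ht]; rfl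
  obtain ⟨B₁, hB₁, hB₁'⟩ := exists_exceptional_set hsne hξ ν (M.μ k) hν hb
    (starConvex_Q hΘ hh₀ k).1 (starConvex_Q hΘ hh₀ k).2
    (hreg.pointwiseSeparable_Q hsepH hsepΘ k)
    (by rintro _ ⟨h, hh, θ, hθ, rfl⟩; exact (hreg.measurable_res hh k).mul (hreg.measurable_test hθ))
    hGm (hreg.bounded_Y k)
    (by
      rintro _ ⟨h, hh, θ, hθ, rfl⟩ o ho
      rw [abs_mul]
      exact (mul_le_mul (hreg.abs_res_le hh ho) (hreg.bounded_Θ k θ hθ _) (abs_nonneg _)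
        hLα).trans hαθb)
  obtain ⟨B₂, hB₂, hB₂'⟩ := exists_exceptional_set hsne hξ ν (M.μ k) hν hb
    (starConvex_testClass hΘ k).1 (starConvex_testClass hΘ k).2
    (pointwiseSeparable_testClass hsepΘ k)
    (by rintro _ ⟨θ, hθ, rfl⟩; exact hreg.measurable_test hθ)
    hGm (hreg.bounded_Y k)
    (by rintro _ ⟨θ, hθ, rfl⟩ o ho; exact (hreg.bounded_Θ k θ hθ _).trans hθb)
  have hcrit := ae_pi_cond_of_ae_pi M.law hO s hs (hη k)
  have hYae : ∀ᵐ D ∂(Measure.pi ν), ∀ t ∈ s, D t ∈ G := by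
    rw [ae_all_iff]
    intro t
    by_cases ht : t ∈ s
    · have h1 : ∀ᵐ o ∂(ν t), o ∈ G := by rw [hν t ht]; exact hreg.bounded_Y k
      filter_upwards [(Measure.quasiMeasurePreserving_eval ν t).ae h1] with D hD _ using hD
    · exact ae_of_all _ fun D h => absurd h ht
  -- The almost sure hypotheses are turned into one null set, so that the bad event, which need not
  -- be measurable, is covered by three sets of small outer measure.
  obtain ⟨N, hN, hN0⟩ : ∃ N : Set (Fin n → M.Trial), (∀ D ∉ N, ((M.sub k D).Nonempty →
      ∃ δ : ℝ, IsCriticalRadius (M.sub k D) D (M.Q H Θ k) b δ ∧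
        IsCriticalRadius (M.sub k D) D (M.testClass Θ k) b δ ∧
        8192 * (δ + b * Real.sqrt (Real.log (16 / ξ) / ((M.sub k D).card : ℝ))) ≤ η k D) ∧
      ∀ t ∈ s, D t ∈ G) ∧ (Measure.pi ν) N = 0 :=
    ⟨_, fun D hD => not_not.1 hD, ae_iff.1 (hcrit.and hYae)⟩
  refine (measure_mono (t := (B₁ ∪ B₂) ∪ N) ?_).trans ((measure_union_le _ _).trans ?_)
  · rintro D ⟨⟨hDne, hDbad⟩, hDs⟩
    by_contra hcon
    simp only [Set.mem_union, not_or] at hcon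
    obtain ⟨⟨hD1, hD2⟩, hDN⟩ := hcon
    obtain ⟨hD3, hD4⟩ := hN D hDN
    obtain ⟨δ, hδ1, hδ2, hδη⟩ := hD3 hDne
    rw [hsub D hDs] at hδ1 hδ2 hδη hDbad
    refine hDbad fun h hh θ hθ => ?_
    have c1 := hB₁' D hD1 hD4 δ (η k D) hδ1 hδη _ ⟨h, hh, θ, hθ, rfl⟩
    have c2 := hB₂' D hD2 hD4 δ (η k D) hδ2 hδη _ ⟨θ, hθ, rfl⟩
    have hη0 : 0 ≤ η k D := by
      refine le_trans ?_ hδη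
      have := hδ1.1
      have : 0 ≤ b * Real.sqrt (Real.log (16 / ξ) / (s.card : ℝ)) :=
        mul_nonneg (by linarith) (Real.sqrt_nonneg _)
      positivity
    have hint : ∀ g : M.Trial → ℝ, 0 ≤ ∫ o, g o ^ 2 ∂(M.μ k) := fun g =>
      integral_nonneg fun o => sq_nonneg _
    refine ⟨c1.2.trans ?_, ?_⟩
    -- The product class concentrates relative to the norm of `α_k(h(X), Y_k) θ(Z_k)`, which is at
    -- most `Lα` times the norm of `θ(Z_k)`.
    · gcongr
      rw [l2norm, l2norm, Real.sqrt_le_left (mul_nonneg hLα (Real.sqrt_nonneg _)), mul_pow,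
        Real.sq_sqrt (hint _), ← integral_const_mul]
      have hi : Integrable (fun o => M.test k θ o ^ 2) (M.μ k) :=
        Integrable.of_bound ((hreg.measurable_test hθ).pow_const 2).aestronglyMeasurable (Lθ ^ 2)
          (ae_of_all _ fun o => by
            rw [norm_pow]; exact pow_le_pow_left₀ (norm_nonneg _) (hreg.bounded_Θ k θ hθ _) 2)
      refine integral_mono_of_nonneg (ae_of_all _ fun o => sq_nonneg _) (hi.const_mul _) ?_
      filter_upwards [hreg.bounded_Y k] with o ho
      rw [mul_pow]
      refine mul_le_mul_of_nonneg_right ?_ (sq_nonneg _)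
      exact sq_le_sq' (abs_le.1 (hreg.abs_res_le hh ho)).1 (abs_le.1 (hreg.abs_res_le hh ho)).2
    · rw [l2norm, Real.sq_sqrt (hint _), empNorm, Real.sq_sqrt]
      · exact c2.1
      · exact div_nonneg (Finset.sum_nonneg fun _ _ => sq_nonneg _) (Nat.cast_nonneg _)
  · rw [hN0, add_zero, two_mul, ENNReal.ofReal_add hξ.1.le hξ.1.le]
    exact (measure_union_le _ _).trans (add_le_add hB₁ hB₂)

/-- The probability that all subsamples are non-empty and the deviation event fails. -/
lemma pi_not_event_le (hreg : M.Regular H Θ Lα₁ LY Lh Lθ Lα) {h₀ : M.Fns}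
    (hh₀ : h₀ ∈ M.hyp H)
    (hΘ : ∀ k, (0 : M.Inst k → ℝ) ∈ Θ k ∧ StarConvex ℝ 0 (Θ k))
    (hsepH : ∀ j, PointwiseSeparable (H j)) (hsepΘ : ∀ k, PointwiseSeparable (Θ k))
    {ξ b : ℝ} (hξ : ξ ∈ Set.Ioo (0 : ℝ) 1) (hb : 1 ≤ b) (hθb : Lθ ≤ b) (hαθb : Lα * Lθ ≤ b)
    {n : ℕ} {η : Fin (m + 1) → (Fin n → M.Trial) → ℝ}
    (hη : M.BoundsCriticalRadius H Θ 8192 16 b ξ η) :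
    (Measure.pi fun _ : Fin n => M.law)
      {D | (∀ k, (M.sub k D).Nonempty) ∧ D ∉ M.event H Θ Lα η}
      ≤ ENNReal.ofReal (2 * ((m : ℝ) + 1) * ξ) := by
  have hsum : ENNReal.ofReal (2 * ((m : ℝ) + 1) * ξ) =
      ∑ _k : Fin (m + 1), ENNReal.ofReal (2 * ξ) := by
    rw [← ENNReal.ofReal_sum_of_nonneg fun _ _ => by linarith [hξ.1]]
    congr 1
    simp
    ring
  rw [hsum]
  refine le_trans ?_ (Finset.sum_le_sum fun k _ =>
    pi_not_deviation_le hreg hh₀ hΘ hsepH hsepΘ hξ hb hθb hαθb hη k)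
  refine (measure_mono ?_).trans (measure_iUnion_fintype_le _ _)
  rintro D ⟨hD, hD'⟩
  rw [Set.mem_iUnion]
  by_contra hcon
  refine hD' fun h hh k θ hθ => ?_
  by_contra hbad
  exact hcon ⟨k, hD k, fun hall => hbad (hall h hh θ hθ)⟩

end MomentSystem
end IES

namespace IES

/-! ### Inequalities in `L²` -/

section L2

variable {Ω : Type*} [MeasurableSpace Ω] {μ : Measure Ω}

lemma sq_l2norm (f : Ω → ℝ) : l2norm μ f ^ 2 = ∫ o, f o ^ 2 ∂μ :=
  Real.sq_sqrt (integral_nonneg fun _ => sq_nonneg _)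

/-- The Cauchy–Schwarz inequality. -/
lemma abs_integral_mul_le {f g : Ω → ℝ} (hf : MemLp f 2 μ) (hg : MemLp g 2 μ) :
    |∫ o, f o * g o ∂μ| ≤ l2norm μ f * l2norm μ g := by
  have hfg : Integrable (fun o => f o * g o) μ := hf.integrable_mul hg
  have hd : discrim (∫ o, g o ^ 2 ∂μ) (2 * ∫ o, f o * g o ∂μ) (∫ o, f o ^ 2 ∂μ) ≤ 0 := by
    refine discrim_le_zero fun c => ?_
    have : ∫ o, (c * g o + f o) ^ 2 ∂μ = (∫ o, g o ^ 2 ∂μ) * (c * c)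
        + (2 * ∫ o, f o * g o ∂μ) * c + ∫ o, f o ^ 2 ∂μ := by
      rw [← integral_const_mul, ← integral_mul_const, ← integral_mul_const, ← integral_add,
        ← integral_add]
      · exact integral_congr_ae (ae_of_all _ fun o => by ring)
      · exact (hg.integrable_sq.mul_const _).add ((hfg.const_mul _).mul_const _)
      · exact hf.integrable_sq
      · exact hg.integrable_sq.mul_const _
      · exact (hfg.const_mul _).mul_const _
    rw [← this]
    exact integral_nonneg fun o => sq_nonneg _
  rw [l2norm, l2norm, ← Real.sqrt_mul (integral_nonneg fun o => sq_nonneg _)]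
  refine Real.abs_le_sqrt ?_
  rw [discrim] at hd
  linarith

lemma l2norm_le_add {f g : Ω → ℝ} (hf : MemLp f 2 μ) (hg : MemLp g 2 μ) :
    l2norm μ f ≤ l2norm μ g + l2norm μ (fun o => g o - f o) := by
  have h1 : 0 ≤ l2norm μ g := Real.sqrt_nonneg _
  have h2 : 0 ≤ l2norm μ (fun o => g o - f o) := Real.sqrt_nonneg _
  refine le_of_sq_le_sq ?_ (add_nonneg h1 h2)
  have hgf : MemLp (fun o => g o - f o) 2 μ := hg.sub hf
  have hcs := (abs_le.1 (abs_integral_mul_le hg hgf)).1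
  have hi : Integrable (fun o => g o * (g o - f o)) μ := hg.integrable_mul hgf
  have e : ∫ o, f o ^ 2 ∂μ = ∫ o, g o ^ 2 ∂μ - 2 * (∫ o, g o * (g o - f o) ∂μ)
      + ∫ o, (g o - f o) ^ 2 ∂μ := by
    rw [← integral_const_mul, ← integral_sub hg.integrable_sq (hi.const_mul 2),
      ← integral_add _ hgf.integrable_sq]
    · exact integral_congr_ae (ae_of_all _ fun o => by simp only; ring)
    · exact hg.integrable_sq.sub (hi.const_mul 2)
  rw [sq_l2norm, e, ← sq_l2norm, ← sq_l2norm (fun o => g o - f o)]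
  nlinarith

/-- With `W = a + h + r + (1 + L) s` the hypothesis gives `t² ≤ 4(W + d) t + 16W²`. If `t > 8W +
4d`, then `t (t - 4(W + d)) ≥ 32W²`, which forces `W = 0` and then contradicts `t² ≤ 4dt`. -/
lemma le_of_quadratic {a h r s L d t : ℝ} (ha : 0 ≤ a) (hh : 0 ≤ h) (hr : 0 ≤ r) (hs : 0 ≤ s)
    (hL : 0 ≤ L) (hd : 0 ≤ d) (ht : 0 ≤ t)
    (hquad : 1 / 4 * t ^ 2 ≤ (a + d + L * s) * t
      + (2 * h ^ 2 + (2 * L ^ 2 + 5 / 2) * s ^ 2 + r ^ 2)) :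
    t ≤ 8 * (a + h + r + (1 + L) * s) + 4 * d := by
  set W := a + h + r + (1 + L) * s with hW
  have hLs : 0 ≤ L * s := by positivity
  have hW0 : 0 ≤ W := by positivity
  have hq : 2 * h ^ 2 + (2 * L ^ 2 + 5 / 2) * s ^ 2 + r ^ 2 ≤ 4 * W ^ 2 := by
    have : 0 ≤ 4 * W ^ 2 - (2 * h ^ 2 + (2 * L ^ 2 + 5 / 2) * s ^ 2 + r ^ 2) := by
      have e : 4 * W ^ 2 - (2 * h ^ 2 + (2 * L ^ 2 + 5 / 2) * s ^ 2 + r ^ 2) =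
          2 * h ^ 2 + 3 * r ^ 2 + (2 * L ^ 2 + 8 * L + 3 / 2) * s ^ 2 + 4 * a ^ 2 +
          8 * (a * h + a * r + a * ((1 + L) * s) + h * r + h * ((1 + L) * s)
            + r * ((1 + L) * s)) := by rw [hW]; ring
      rw [e]; positivity
    linarith
  have hp : (a + d + L * s) * t ≤ (W + d) * t := by
    refine mul_le_mul_of_nonneg_right ?_ ht
    rw [hW]; linarith
  by_contra hcon
  push Not at hcon
  have h1 : 8 * W * (4 * W) ≤ t * (t - 4 * (W + d)) := by
    refine mul_le_mul ?_ ?_ (by positivity) ht <;> linarith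
  have h2 : t ^ 2 ≤ 4 * (W + d) * t + 16 * W ^ 2 := by linarith
  have h3 : W ^ 2 = 0 := le_antisymm (by nlinarith) (sq_nonneg _)
  have h4 : W = 0 := by simpa using h3
  rw [h4] at h2 hcon
  nlinarith

end L2

/-! ### Deterministic consequences of the deviation event -/

namespace MomentSystem

universe u v w

variable {m : ℕ} {M : MomentSystem.{u, v, w} m} {H : ∀ j, Set (M.Arg j → ℝ)}
  {Θ : ∀ k, Set (M.Inst k → ℝ)} {Lα₁ LY Lh Lθ Lα : ℝ}

lemma Regular.memLp_res (hreg : M.Regular H Θ Lα₁ LY Lh Lθ Lα) {h : M.Fns}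
    (hh : h ∈ M.hyp H) (k : Fin (m + 1)) : MemLp (M.res k h) 2 (M.μ k) :=
  MemLp.of_bound (hreg.measurable_res hh k).aestronglyMeasurable Lα
    ((hreg.bounded_Y k).mono fun _ ho => hreg.abs_res_le hh ho)

lemma Regular.memLp_T (hreg : M.Regular H Θ Lα₁ LY Lh Lθ Lα) {h : M.Fns}
    (hh : h ∈ M.hyp H) (k : Fin (m + 1)) : MemLp (M.T k h) 2 (M.μ k) :=
  (hreg.memLp_res hh k).condExp one_le_two

lemma Regular.memLp_test (hreg : M.Regular H Θ Lα₁ LY Lh Lθ Lα) {k : Fin (m + 1)}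
    {θ : M.Inst k → ℝ} (hθ : θ ∈ Θ k) : MemLp (M.test k θ) 2 (M.μ k) :=
  MemLp.of_bound (hreg.measurable_test hθ).aestronglyMeasurable Lθ
    (ae_of_all _ fun _ => hreg.bounded_Θ k θ hθ _)

/-- The test function depends on `Z_k` only and can be pulled out of the conditional expectation. -/
lemma Regular.integral_res_mul_test (hreg : M.Regular H Θ Lα₁ LY Lh Lθ Lα) {h : M.Fns}
    (hh : h ∈ M.hyp H) {k : Fin (m + 1)} {θ : M.Inst k → ℝ} (hθ : θ ∈ Θ k) :
    ∫ o, M.res k h o * M.test k θ o ∂(M.μ k) = ∫ o, M.T k h o * M.test k θ o ∂(M.μ k) := by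
  have hle : MeasurableSpace.comap (M.Z k) inferInstance ≤ M.measTrial :=
    (M.measurable_Z k).comap_le
  have hsm : StronglyMeasurable[MeasurableSpace.comap (M.Z k) inferInstance] (M.test k θ) :=
    ((hreg.measurable_Θ k θ hθ).comp (comap_measurable (M.Z k))).stronglyMeasurable
  have hint : Integrable (M.res k h * M.test k θ) (M.μ k) :=
    (hreg.memLp_res hh k).integrable_mul (hreg.memLp_test hθ)
  have h1 := condExp_mul_of_stronglyMeasurable_right (μ := M.μ k) hsm hint
    ((hreg.memLp_res hh k).integrable one_le_two)
  calc ∫ o, M.res k h o * M.test k θ o ∂(M.μ k)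
      = ∫ o, (M.res k h * M.test k θ) o ∂(M.μ k) := rfl
    _ = _ := (integral_condExp hle).symm
    _ = _ := integral_congr_ae h1

section Loss

variable {n : ℕ} {D : Fin n → M.Trial}

lemma empMean_zero_test (k : Fin (m + 1)) (h : M.Fns) :
    empMean (M.sub k D) D (fun o => M.res k h o * M.test k (0 : M.Inst k → ℝ) o)
      - 1 / 2 * empNorm (M.sub k D) D (M.test k (0 : M.Inst k → ℝ)) ^ 2 = 0 := by
  simp [empMean, empNorm, test]

lemma Regular.bddAbove_lossK (hreg : M.Regular H Θ Lα₁ LY Lh Lθ Lα) (k : Fin (m + 1))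
    (h : M.Fns) : BddAbove (Set.range fun θ : Θ k =>
      empMean (M.sub k D) D (fun o => M.res k h o * M.test k θ.1 o)
        - 1 / 2 * empNorm (M.sub k D) D (M.test k θ.1) ^ 2) := by
  refine ⟨(∑ t ∈ M.sub k D, |M.res k h (D t)| * Lθ) / ((M.sub k D).card : ℝ), ?_⟩
  rintro _ ⟨⟨θ, hθ⟩, rfl⟩
  refine (sub_le_self _ (by positivity)).trans ?_
  unfold empMean
  gcongr with t ht
  refine (le_abs_self _).trans ?_
  rw [abs_mul]
  gcongr
  exact hreg.bounded_Θ k θ hθ _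

lemma Regular.lossK_nonneg (hreg : M.Regular H Θ Lα₁ LY Lh Lθ Lα)
    (hΘ : ∀ k, (0 : M.Inst k → ℝ) ∈ Θ k) (k : Fin (m + 1)) (h : M.Fns) :
    0 ≤ M.lossK Θ D k h :=
  (empMean_zero_test k h).symm.le.trans (le_ciSup (hreg.bddAbove_lossK k h) ⟨0, hΘ k⟩)

lemma Regular.loss_nonneg (hreg : M.Regular H Θ Lα₁ LY Lh Lθ Lα)
    (hΘ : ∀ k, (0 : M.Inst k → ℝ) ∈ Θ k) (h : M.Fns) : 0 ≤ M.loss Θ D h :=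
  Finset.sum_nonneg fun k _ => hreg.lossK_nonneg hΘ k h

variable {η : Fin (m + 1) → (Fin n → M.Trial) → ℝ}

lemma lossK_le_of_mem_event (hreg : M.Regular H Θ Lα₁ LY Lh Lθ Lα)
    (hΘ : ∀ k, (0 : M.Inst k → ℝ) ∈ Θ k) (hD : D ∈ M.event H Θ Lα η) {h : M.Fns}
    (hh : h ∈ M.hyp H) (k : Fin (m + 1)) :
    M.lossK Θ D k h ≤ 2 * l2norm (M.μ k) (M.T k h) ^ 2 + (2 * Lα ^ 2 + 5 / 4) * η k D ^ 2 := by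
  have : Nonempty (Θ k) := ⟨⟨0, hΘ k⟩⟩
  refine ciSup_le fun ⟨θ, hθ⟩ => ?_
  obtain ⟨h1, h2⟩ := hD h hh k θ hθ
  have h3 := (abs_le.1 h1).2
  have h4 := (abs_le.1 h2).1
  have h5 := (abs_le.1 (abs_integral_mul_le (hreg.memLp_T hh k) (hreg.memLp_test hθ))).2
  rw [hreg.integral_res_mul_test hh hθ] at h3
  set t := l2norm (M.μ k) (M.test k θ)
  set a := l2norm (M.μ k) (M.T k h)
  simp only
  -- The objective is at most `(a + ηLα) t - t²/4 + 5η²/4`, where `5/4` is 1 from the mean and `1/4`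
  -- from the norm. The first square maximizes over `t`, the second splits `(a + ηLα)²`.
  nlinarith [sq_nonneg (t / 2 - (a + η k D * Lα)), sq_nonneg (a - η k D * Lα)]

lemma loss_le_of_mem_event (hreg : M.Regular H Θ Lα₁ LY Lh Lθ Lα)
    (hΘ : ∀ k, (0 : M.Inst k → ℝ) ∈ Θ k) (hD : D ∈ M.event H Θ Lα η)
    {V : Set (Measure (M.Arg (Fin.last m)))} {gstar : M.Arg (Fin.last m) → ℝ} {hH : M.Fns}
    {εH : ℝ} (hreal : M.Realizable H V gstar εH hH) :
    M.loss Θ D hH ≤ 2 * εH ^ 2 + (2 * Lα ^ 2 + 5 / 4) * ∑ k, η k D ^ 2 := by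
  obtain ⟨hh, hr, -⟩ := hreal
  have h1 : ∑ k, l2norm (M.μ k) (M.T k hH) ^ 2 ≤ εH ^ 2 := (Real.sqrt_le_iff.1 hr).2
  calc M.loss Θ D hH ≤ ∑ k, (2 * l2norm (M.μ k) (M.T k hH) ^ 2
        + (2 * Lα ^ 2 + 5 / 4) * η k D ^ 2) :=
        Finset.sum_le_sum fun k _ => lossK_le_of_mem_event hreg hΘ hD hh k
    _ = 2 * (∑ k, l2norm (M.μ k) (M.T k hH) ^ 2) + (2 * Lα ^ 2 + 5 / 4) * ∑ k, η k D ^ 2 := by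
        rw [Finset.sum_add_distrib, ← Finset.mul_sum, ← Finset.mul_sum]
    _ ≤ _ := by gcongr

lemma mem_conf_of_mem_event (hreg : M.Regular H Θ Lα₁ LY Lh Lθ Lα)
    (hΘ : ∀ k, (0 : M.Inst k → ℝ) ∈ Θ k) {h : M.Fns} (hh : h ∈ M.hyp H) {e : ℝ}
    (he : M.loss Θ D h ≤ e) : h (Fin.last m) ∈ M.conf H Θ D e := by
  refine ⟨hh _, h, ⟨hh, ?_⟩, rfl⟩
  have : 0 ≤ ⨅ h' : M.hyp H, M.loss Θ D h'.1 :=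
    Real.iInf_nonneg fun h' => hreg.loss_nonneg hΘ _
  linarith

/-- A test function `θ` near `T_k h`, of norm `t`, pairs with it to about `t²`, while half its
squared empirical norm is at most about `3t²/4`. The loss of `h` therefore exceeds `t²/4` up to
lower-order terms, and it is at most the loss of `hH` plus the threshold. -/
lemma l2norm_T_le_of_mem_confH (hreg : M.Regular H Θ Lα₁ LY Lh Lθ Lα)
    (hΘ : ∀ k, (0 : M.Inst k → ℝ) ∈ Θ k) (hD : D ∈ M.event H Θ Lα η)
    {V : Set (Measure (M.Arg (Fin.last m)))} {gstar : M.Arg (Fin.last m) → ℝ} {hH : M.Fns}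
    {εH εΘ : ℝ} (hreal : M.Realizable H V gstar εH hH) (hcomp : M.Compatible H Θ εΘ) {e : ℝ}
    {h : M.Fns} (hh : h ∈ M.confH H Θ D e) (k : Fin (m + 1)) :
    l2norm (M.μ k) (M.T k h)
      ≤ 9 * (εΘ + εH + Real.sqrt e + (1 + Lα) * Real.sqrt (∑ k, η k D ^ 2)) := by
  obtain ⟨hh, hloss⟩ := hh
  have : Nonempty (Θ k) := ⟨⟨0, hΘ k⟩⟩
  have hLα := hreg.nonneg_Lα hh
  have hεH : 0 ≤ εH := (Real.sqrt_nonneg _).trans hreal.2.1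
  have hεΘ : 0 ≤ εΘ := (Real.iInf_nonneg fun _ => Real.sqrt_nonneg _).trans (hcomp h hh k)
  set S := ∑ k, η k D ^ 2 with hS
  have hS0 : 0 ≤ S := Finset.sum_nonneg fun k _ => sq_nonneg _
  set s := Real.sqrt S with hs
  have hs0 : 0 ≤ s := Real.sqrt_nonneg _
  have hsS : s ^ 2 = S := Real.sq_sqrt hS0
  have hηs : η k D ^ 2 ≤ s ^ 2 := by
    rw [hsS]
    exact Finset.single_le_sum (f := fun k => η k D ^ 2) (fun k _ => sq_nonneg _)
      (Finset.mem_univ k)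
  have hηs' : η k D ≤ s := (abs_le_of_sq_le_sq' hηs hs0).2
  set r := Real.sqrt e with hr
  have hr0 : 0 ≤ r := Real.sqrt_nonneg _
  -- For negative `e` the square root is 0 and the bound still holds.
  have her : e ≤ r ^ 2 := by
    rcases le_total 0 e with he | he
    · rw [hr, Real.sq_sqrt he]
    · exact he.trans (sq_nonneg _)
  have hinf : (⨅ h' : M.hyp H, M.loss Θ D h'.1) ≤ M.loss Θ D hH :=
    ciInf_le (f := fun h' : M.hyp H => M.loss Θ D h'.1)
      ⟨0, by rintro _ ⟨h', rfl⟩; exact hreg.loss_nonneg hΘ _⟩ ⟨hH, hreal.1⟩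
  have hlossH := loss_le_of_mem_event hreg hΘ hD hreal
  have hlossK : M.lossK Θ D k h ≤ M.loss Θ D h :=
    Finset.single_le_sum (f := fun k => M.lossK Θ D k h)
      (fun k _ => hreg.lossK_nonneg hΘ k h) (Finset.mem_univ k)
  set W := εΘ + εH + r + (1 + Lα) * s with hW
  have hLs : 0 ≤ Lα * s := mul_nonneg hLα hs0
  have hW0 : 0 ≤ W := by positivity
  -- The compatibility infimum need not be attained. A slack of `d / 5` in the choice of `θ` enters
  -- four times through `t` and once through the triangle inequality, in total `d`.
  refine le_of_forall_pos_le_add fun d hd => ?_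
  obtain ⟨⟨θ, hθ⟩, hθd⟩ := exists_lt_of_ciInf_lt
    (lt_of_le_of_lt (hcomp h hh k) (by linarith : εΘ < εΘ + d / 5))
  simp only at hθd
  obtain ⟨h1, h2⟩ := hD h hh k θ hθ
  have h3 := (abs_le.1 h1).1
  have h4 := (abs_le.1 h2).2
  rw [hreg.integral_res_mul_test hh hθ] at h3
  have h5 := le_ciSup (hreg.bddAbove_lossK (D := D) k h) ⟨θ, hθ⟩
  simp only at h5
  change _ ≤ M.lossK Θ D k h at h5
  have hmT := hreg.memLp_T hh k
  have hmθ := hreg.memLp_test (M := M) hθ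
  have htri := l2norm_le_add hmT hmθ
  have hmd : MemLp (fun o => M.test k θ o - M.T k h o) 2 (M.μ k) := hmθ.sub hmT
  have hcs := (abs_le.1 (abs_integral_mul_le hmd hmθ)).2
  have hi : Integrable (fun o => (M.test k θ o - M.T k h o) * M.test k θ o) (M.μ k) :=
    hmd.integrable_mul hmθ
  have hsplit : ∫ o, M.T k h o * M.test k θ o ∂(M.μ k) = l2norm (M.μ k) (M.test k θ) ^ 2
      - ∫ o, (M.test k θ o - M.T k h o) * M.test k θ o ∂(M.μ k) := by
    rw [sq_l2norm, ← integral_sub hmθ.integrable_sq hi]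
    exact integral_congr_ae (ae_of_all _ fun o => by simp only; ring)
  set t := l2norm (M.μ k) (M.test k θ) with ht
  have ht0 : 0 ≤ t := Real.sqrt_nonneg _
  set ε' := l2norm (M.μ k) (fun o => M.test k θ o - M.T k h o)
  rw [hsplit] at h3
  have hηt : η k D * (Lα * t + η k D) ≤ s * (Lα * t) + s ^ 2 := by
    have := mul_le_mul_of_nonneg_right hηs' (mul_nonneg hLα ht0)
    nlinarith
  have hε't : ε' * t ≤ (εΘ + d / 5) * t := mul_le_mul_of_nonneg_right hθd.le ht0
  -- The coefficient `5/2` adds the `5/4` from the loss of `hH` to the `1 + 1/4` lost in the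
  -- deviation inequalities for `h`.
  have hquad : 1 / 4 * t ^ 2 ≤ (εΘ + d / 5 + Lα * s) * t
      + (2 * εH ^ 2 + (2 * Lα ^ 2 + 5 / 2) * s ^ 2 + r ^ 2) := by
    rw [← hS, ← hsS] at hlossH
    nlinarith
  have htW : t ≤ 8 * W + 4 * (d / 5) := le_of_quadratic hεΘ hεH hr0 hs0 hLα (by positivity) ht0 hquad
  have hεW : εΘ ≤ W := by rw [hW]; linarith
  linarith

end Loss

end MomentSystem
end IES

theorem mainTheorem3 :
    ∃ c₀ c₁ c₂ : ℝ, 0 < c₀ ∧ 1 ≤ c₁ ∧ 0 < c₂ ∧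
    ∀ (m : ℕ) (M : IES.MomentSystem m)
      (H : ∀ j, Set (M.Arg j → ℝ)) (Θ : ∀ k, Set (M.Inst k → ℝ))
      (Lα₁ LY Lh Lθ Lα b εH εΘ ξ : ℝ)
      (V : Set (Measure (M.Arg (Fin.last m)))) (gstar : M.Arg (Fin.last m) → ℝ) (hH : M.Fns)
      (n : ℕ) (η : Fin (m + 1) → (Fin n → M.Trial) → ℝ),
      M.Realizable H V gstar εH hH →
      M.Compatible H Θ εΘ →
      M.Regular H Θ Lα₁ LY Lh Lθ Lα →
      (∀ k, (0 : M.Inst k → ℝ) ∈ Θ k ∧ StarConvex ℝ 0 (Θ k)) →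
      (∀ j, IES.PointwiseSeparable (H j)) →
      (∀ k, IES.PointwiseSeparable (Θ k)) →
      ξ ∈ Set.Ioo (0 : ℝ) 1 →
      1 ≤ b → Lθ ≤ b → Lα * Lθ ≤ b →
      M.BoundsCriticalRadius H Θ c₀ c₁ b ξ η →
      (Measure.pi (fun _ : Fin n => M.law))
          {D | (∀ k, (M.sub k D).Nonempty) ∧ D ∉ M.event H Θ Lα η}
        ≤ ENNReal.ofReal (2 * ((m : ℝ) + 1) * ξ) ∧
      ∀ D ∈ M.event H Θ Lα η,
        M.loss Θ D hH ≤ 2 * εH ^ 2 + (2 * Lα ^ 2 + 5 / 4) * ∑ k, η k D ^ 2 ∧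
        (∀ e : ℝ, 2 * εH ^ 2 + (2 * Lα ^ 2 + 5 / 4) * ∑ k, η k D ^ 2 < e →
          hH (Fin.last m) ∈ M.conf H Θ D e) ∧
        (∀ e : ℝ, ∀ h ∈ M.confH H Θ D e, ∀ k,
          IES.l2norm (M.μ k) (M.T k h)
            ≤ c₂ * (εΘ + εH + Real.sqrt e + (1 + Lα) * Real.sqrt (∑ k, η k D ^ 2))) := by
  -- `8192` is twice the concentration scale 4096, `16` sums the tails over dyadic radii, and `9 = 8
  -- + 1` combines the bound on `t` with the distance from `θ` to `T_k h`.
  refine ⟨8192, 16, 9, by norm_num, by norm_num, by norm_num, ?_⟩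
  intro m M H Θ Lα₁ LY Lh Lθ Lα b εH εΘ ξ V gstar hH n η hreal hcomp hreg hΘ hsepH hsepΘ hξ hb
    hθb hαθb hη
  have hΘ0 := fun k => (hΘ k).1
  refine ⟨IES.MomentSystem.pi_not_event_le hreg hreal.1 hΘ hsepH hsepΘ hξ hb hθb hαθb hη,
    fun D hD => ?_⟩
  have hloss := IES.MomentSystem.loss_le_of_mem_event hreg hΘ0 hD hreal
  exact ⟨hloss,
    fun e he => IES.MomentSystem.mem_conf_of_mem_event hreg hΘ0 hreal.1 (hloss.trans he.le),
    fun e h hh k => IES.MomentSystem.l2norm_T_le_of_mem_confH hreg hΘ0 hD hreal hcomp hh k⟩
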